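/- All algebras are real, not necessarily associative, unital or finite-dimensional. All grading groups are abelian, and isomorphisms of graded algebras preserve degrees. The centroid $C(\mathcal B)$ of an algebra $\mathcal B$ is the algebra of linear endomorphisms of $\mathcal B$ commuting with all left and right multiplications. If $\mathcal B$ is $G$-graded, $C(\mathcal B)_g$ denotes the set of $c\in C(\mathcal B)$ with $c(\mathcal B_h)\subseteq\mathcal B_{gh}$ for all $h\in G$. A graded algebra $\mathcal B$ is graded-simple if $\mathcal B^2\neq0$ and its only graded (two-sided) ideals are $0$ and $\mathcal B$. An algebra $\mathcal A$ is central simple if $\mathcal A^2\ne 0$, its only ideals are $0$ and $\mathcal A$, and $C(\mathcal A)=\mathbb R\,\mathrm{id}$. Fix an epimorphism $\pi:G\to\overline G$ of abelian groups with kernel $H$ (equivalently, $\overline G=G/H$), a homomorphism $\chi:G\to U=\{z\in\mathbb C: |z|=1\}$, and a map $\xi:\overline G\to G$ with $\pi\circ\xi=\mathrm{id}$ (i.e. a transversal of $H$ in $G$). Put $\sigma(p,q)=\xi(p)\xi(q)\xi(pq)^{-1}\in H$ for $p,q\in\overline G$. For a $\overline G$-graded algebra $\mathcal A$, let $L_\pi^\chi(\mathcal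 A)$ be the $G$-graded real algebra of all fixed points of the map $a\otimes z\otimes g\mapsto a\otimes\bar z\chi(g)\otimes g$ in $L_\pi(\mathcal A\otimes\mathbb C)=\bigoplus_{g\in G}\mathcal A_{\pi(g)}\otimes\mathbb C\otimes g\subseteq\mathcal A\otimes\mathbb C\otimes\mathbb R G$. Its component of degree $g$ is $\mathcal A_{\pi(g)}\otimes u_g$, where $u_g=z_g\otimes g$ for any $z_g\in\mathbb C^\times$ with $z_g/\bar z_g=\chi(g)$. For a character $\lambda:H\to\mathbb R^\times$, let $\mathcal A^\lambda$ be the graded space $\mathcal A$ with the product $a_1*a_2=\lambda(\sigma(p,q))\,a_1a_2$ for $a_1\in\mathcal A_p$, $a_2\in\mathcal A_q$. Let $\widetilde{\mathfrak M}$ be the groupoid whose objects are the central simple real algebras equipped with a $\overline G$-grading, and whose morphisms $\mathcal A\to\mathcal A'$ are the pairs $(\psi,\lambda)$ with $\lambda:H\to\mathbb R^\times$ a character and $\psi:\mathcal A^\lambda\to\mathcal A'$ an isomorphism of $\overline G$-graded algebras, with composition $(\psi',\lambda')(\psi,\lambda)=(\psi'\psi,\lambda'\lambda)$. Let $\mathfrak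 N$ be the groupoid whose objects are the graded-simple $G$-graded real algebras $\mathcal B$ such that $C(\mathcal B)\cong L_\pi^\chi(\mathbb R)$ as $G$-graded algebras (with $\mathbb R$ trivially graded), and whose morphisms are the isomorphisms of $G$-graded algebras. **Theorem 3.8.** The assignments $\mathcal A\mapsto L_\pi^\chi(\mathcal A)$ and $$\widetilde{L_\pi^\chi}(\psi,\lambda):\ a\otimes u_g\mapsto \lambda\big(g\,\xi(\pi(g))^{-1}\big)\,\psi(a)\otimes u_g\qquad(g\in G,\ a\in\mathcal A_{\pi(g)})$$ define a functor $\widetilde{L_\pi^\chi}:\widetilde{\mathfrak M}\to\mathfrak N$, and this functor is an equivalence of groupoids. -/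

import Mathlib

open scoped TensorProduct
open CategoryTheory

universe u v w

namespace LoopGr

/-! ### Graded algebras -/

/-- An isomorphism between two (nonassociative) real algebras carrying families of subspaces
indexed by `G`: a linear isomorphism that is multiplicative and satisfies `ψ(𝒜 g) = ℬ g`. -/
structure GradedEquiv {G : Type*} {A B : Type*}
    [NonUnitalNonAssocSemiring A] [Module ℝ A] [NonUnitalNonAssocSemiring B] [Module ℝ B]
    (𝒜 : G → Submodule ℝ A) (ℬ : G → Submodule ℝ B) where
  toLinearEquiv : A ≃ₗ[ℝ] B
  map_mul : ∀ x y, toLinearEquiv (x * y) = toLinearEquiv x * toLinearEquiv y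
  map_mem_iff : ∀ g x, toLinearEquiv x ∈ ℬ g ↔ x ∈ 𝒜 g

/-- A `G`-graded algebra over `ℝ`, not necessarily associative, unital or finite-dimensional:
the space is the internal direct sum of the subspaces `deg g`,
and `(deg g) (deg h) ⊆ deg (g h)`. -/
structure GrAlg (G : Type u) [CommGroup G] where
  carrier : Type w
  [ring : NonUnitalNonAssocRing carrier]
  [module : Module ℝ carrier]
  [scalarTower : IsScalarTower ℝ carrier carrier]
  [smulComm : SMulCommClass ℝ carrier carrier]
  deg : G → Submodule ℝ carrier
  deg_indep : iSupIndep deg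
  deg_iSup : ⨆ g, deg g = ⊤
  mul_mem : ∀ {g h : G} {x y : carrier}, x ∈ deg g → y ∈ deg h → x * y ∈ deg (g * h)

attribute [instance] GrAlg.ring GrAlg.module GrAlg.scalarTower GrAlg.smulComm

/-- The groupoid of `G`-graded real algebras and their graded isomorphisms. -/
instance GrAlg.groupoid (G : Type u) [CommGroup G] : Groupoid (GrAlg.{u, w} G) where
  Hom A B := GradedEquiv A.deg B.deg
  id A := ⟨LinearEquiv.refl ℝ A.carrier, fun _ _ => rfl, fun _ _ => Iff.rfl⟩
  comp f g := ⟨f.toLinearEquiv.trans g.toLinearEquiv,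
    fun x y => by simp [f.map_mul, g.map_mul],
    fun a x => (g.map_mem_iff a _).trans (f.map_mem_iff a x)⟩
  inv f := ⟨f.toLinearEquiv.symm,
    fun x y => f.toLinearEquiv.injective (by simp [f.map_mul]),
    fun a x => by rw [← f.map_mem_iff]; simp⟩
  id_comp f := rfl
  comp_id f := rfl
  assoc f g h := rfl
  inv_comp {A B} f := by
    congr 1
    exact f.toLinearEquiv.symm_trans_self
  comp_inv {A B} f := by
    congr 1
    exact f.toLinearEquiv.self_trans_symm

/-- The centroid: linear endomorphisms commuting with all left and right multiplications. -/
def centroid (A : Type*) [NonUnitalNonAssocRing A] [Module ℝ A] [IsScalarTower ℝ A A]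
    [SMulCommClass ℝ A A] :
    Subalgebra ℝ (Module.End ℝ A) where
  carrier := {f | ∀ x y, f (x * y) = x * f y ∧ f (x * y) = f x * y}
  mul_mem' {f g} hf hg x y := by
    simp only [Module.End.mul_apply]
    exact ⟨by rw [(hg x y).1, (hf _ _).1], by rw [(hg x y).2, (hf _ _).2]⟩
  add_mem' {f g} hf hg x y := by
    simp only [LinearMap.add_apply]
    exact ⟨by rw [(hf x y).1, (hg x y).1, mul_add], by rw [(hf x y).2, (hg x y).2, add_mul]⟩
  algebraMap_mem' r x y := by
    simp [Module.algebraMap_end_apply, mul_smul_comm, smul_mul_assoc]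

namespace GrAlg

variable {G : Type u} [CommGroup G]

/-- The elements of the centroid that are homogeneous of degree `g`. -/
def centroidDeg (B : GrAlg.{u, w} G) (g : G) : Submodule ℝ (centroid B.carrier) where
  carrier := {c | ∀ (h : G), ∀ x ∈ B.deg h, (c : Module.End ℝ B.carrier) x ∈ B.deg (g * h)}
  add_mem' ha hb h x hx := add_mem (ha h x hx) (hb h x hx)
  zero_mem' h _ _ := zero_mem (B.deg (g * h))
  smul_mem' r _ ha h x hx := (B.deg (g * h)).smul_mem r (ha h x hx)

/-- Graded-simple: the product is not identically zero, and the only graded two-sided ideals are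
`0` and the whole algebra. -/
def IsGradedSimple (B : GrAlg.{u, w} G) : Prop :=
  (∃ x y : B.carrier, x * y ≠ 0) ∧
  ∀ I : Submodule ℝ B.carrier,
    (∀ a, ∀ x ∈ I, a * x ∈ I ∧ x * a ∈ I) → I = ⨆ g, I ⊓ B.deg g → I = ⊥ ∨ I = ⊤

/-- Central simple (the grading plays no role): the product is not identically zero, the only
two-sided ideals are `0` and the whole algebra, and the centroid consists of the scalars. -/
def IsCentralSimple (A : GrAlg.{u, w} G) : Prop :=
  (∃ x y : A.carrier, x * y ≠ 0) ∧
  (∀ I : Submodule ℝ A.carrier, (∀ a, ∀ x ∈ I, a * x ∈ I ∧ x * a ∈ I) → I = ⊥ ∨ I = ⊤) ∧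
  centroid A.carrier = ⊥

/-- The field `ℝ` with the trivial grading, concentrated in degree `1`. -/
def trivialReal (G : Type u) [CommGroup G] : GrAlg.{u, 0} G where
  carrier := ℝ
  deg g := ⨆ _ : g = 1, ⊤
  deg_indep := by
    intro g
    by_cases hg : g = 1
    · subst hg
      have : (⨆ (j : G) (_ : j ≠ 1), ⨆ _ : j = 1, (⊤ : Submodule ℝ ℝ)) = ⊥ := by
        simp +contextual
      rw [this]; exact disjoint_bot_right
    · simp [hg]
  deg_iSup := by simp
  mul_mem {g h x y} hx hy := by
    by_cases hg : g = 1
    · by_cases hh : h = 1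
      · simp [hg, hh]
      · have : y = 0 := by simpa [hh] using hy
        subst this; simp
    · have : x = 0 := by simpa [hg] using hx
      subst this; simp

/-! ### Decomposition into homogeneous components and twists -/

open scoped Classical in
/-- The decomposition of a graded algebra as a direct sum of its homogeneous components. -/
noncomputable def decomp (A : GrAlg.{u, w} G) : A.carrier ≃ₗ[ℝ] DirectSum G (fun g => A.deg g) :=
  (LinearEquiv.ofBijective (DirectSum.coeLinearMap A.deg)
    (DirectSum.isInternal_submodule_of_iSupIndep_of_iSup_eq_top A.deg_indep A.deg_iSup)).symm

open scoped Classical in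
theorem decomp_of_mem (A : GrAlg.{u, w} G) {g : G} {x : A.carrier} (hx : x ∈ A.deg g) :
    A.decomp x = DirectSum.lof ℝ G (fun g => A.deg g) g ⟨x, hx⟩ := by
  rw [decomp, LinearEquiv.symm_apply_eq]
  exact (DirectSum.coeLinearMap_lof A.deg g ⟨x, hx⟩).symm

open scoped Classical in
/-- The linear operator multiplying the component of degree `g` by `s g`. -/
noncomputable def scale (A : GrAlg.{u, w} G) (s : G → ℝ) : A.carrier →ₗ[ℝ] A.carrier :=
  DirectSum.toModule ℝ G A.carrier (fun g => s g • (A.deg g).subtype) ∘ₗ A.decomp.toLinearMap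

theorem scale_of_mem (A : GrAlg.{u, w} G) (s : G → ℝ) {g : G} {x : A.carrier}
    (hx : x ∈ A.deg g) : A.scale s x = s g • x := by
  classical
  simp [scale, decomp_of_mem A hx, DirectSum.toModule_lof]

open scoped Classical in
/-- The bilinear product with `x ∗ y = c g₁ g₂ • (x * y)` for `x` of degree `g₁` and `y` of
degree `g₂`. -/
noncomputable def twistMul (A : GrAlg.{u, w} G) (c : G → G → ℝ) :
    A.carrier →ₗ[ℝ] A.carrier →ₗ[ℝ] A.carrier :=
  DirectSum.toModule ℝ G (A.carrier →ₗ[ℝ] A.carrier)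
    (fun g₁ => (LinearMap.mul ℝ A.carrier).compl₂ (A.scale (c g₁)) ∘ₗ (A.deg g₁).subtype) ∘ₗ
    A.decomp.toLinearMap

theorem twistMul_of_mem (A : GrAlg.{u, w} G) (c : G → G → ℝ) {g₁ g₂ : G} {x y : A.carrier}
    (hx : x ∈ A.deg g₁) (hy : y ∈ A.deg g₂) : A.twistMul c x y = c g₁ g₂ • (x * y) := by
  classical
  simp [twistMul, decomp_of_mem A hx, DirectSum.toModule_lof, scale_of_mem A _ hy]

/-- The nonassociative ring with the additive group of `A` and the product `twistMul`. -/
@[reducible] noncomputable def twistRing (A : GrAlg.{u, w} G) (c : G → G → ℝ) :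
    NonUnitalNonAssocRing A.carrier :=
  { (inferInstance : AddCommGroup A.carrier) with
    mul := fun x y => A.twistMul c x y
    left_distrib := fun x y z => map_add (A.twistMul c x) y z
    right_distrib := fun x y z => LinearMap.map_add₂ (A.twistMul c) x y z
    zero_mul := fun x => LinearMap.map_zero₂ (A.twistMul c) x
    mul_zero := fun x => map_zero (A.twistMul c x) }

/-- The twist of `A` by a function `c`: the same graded space, with the product `twistMul`. -/
noncomputable def twistBy (A : GrAlg.{u, w} G) (c : G → G → ℝ) : GrAlg.{u, w} G :=
  letI := A.twistRing c
  { carrier := A.carrier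
    ring := A.twistRing c
    module := A.module
    scalarTower := ⟨fun r x y => LinearMap.map_smul₂ (A.twistMul c) r x y⟩
    smulComm := ⟨fun r x y => (map_smul (A.twistMul c x) r y).symm⟩
    deg := A.deg
    deg_indep := A.deg_indep
    deg_iSup := A.deg_iSup
    mul_mem := fun {g h x y} hx hy => by
      change A.twistMul c x y ∈ _
      rw [A.twistMul_of_mem c hx hy]
      exact (A.deg (g * h)).smul_mem _ (A.mul_mem hx hy) }

end GrAlg

/-! ### Twists by characters of the kernel, and the source groupoid -/

section Twist

variable {G : Type u} {Gbar : Type v} [CommGroup G] [CommGroup Gbar] (π : G →* Gbar)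
  (ξ : Gbar → G) (hξ : Function.RightInverse ξ π)

/-- The 2-cocycle `σ(p, q) = ξ(p) ξ(q) ξ(pq)⁻¹` with values in `H = ker π` attached to a section
`ξ` of `π`. -/
def cocycle (p q : Gbar) : π.ker :=
  ⟨ξ p * ξ q * (ξ (p * q))⁻¹, by simp [MonoidHom.mem_ker, hξ p, hξ q, hξ (p * q)]⟩

/-- For `g` in `G`, the element `g ξ(π(g))⁻¹` of `H = ker π`. -/
def kerPart (g : G) : π.ker :=
  ⟨g * (ξ (π g))⁻¹, by simp [MonoidHom.mem_ker, hξ (π g)]⟩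

/-- The twist `A^lam` of a graded algebra by a real character `lam` of `H = ker π`:
`a₁ ∗ a₂ = lam(σ(p, q)) a₁ a₂` for `a₁` of degree `p` and `a₂` of degree `q`. -/
noncomputable def twist (lam : π.ker →* ℝˣ) (A : GrAlg.{v, w} Gbar) : GrAlg.{v, w} Gbar :=
  A.twistBy (fun p q => (lam (cocycle π ξ hξ p q) : ℝ))

/-- Objects of the extended groupoid: central simple real algebras with a grading by `Gbar`. -/
structure ExtObj (π : G →* Gbar) (ξ : Gbar → G) (hξ : Function.RightInverse ξ π) where
  alg : GrAlg.{v, w} Gbar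
  centralSimple : alg.IsCentralSimple

/-- Morphisms of the extended groupoid: pairs of a real character `lam` of `H = ker π` and a
graded isomorphism from the twist `A^lam` to `A'`. -/
structure ExtHom (A A' : ExtObj.{u, v, w} π ξ hξ) where
  char : π.ker →* ℝˣ
  iso : GradedEquiv (twist π ξ hξ char A.alg).deg A'.alg.deg


variable {π ξ hξ}

/-- Two bilinear maps that agree on homogeneous elements are equal. -/
theorem GrAlg.bilin_ext {A : GrAlg.{v, w} Gbar} {M : Type*} [AddCommGroup M] [Module ℝ M]
    (S T : A.carrier →ₗ[ℝ] A.carrier →ₗ[ℝ] M)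
    (h : ∀ p q, ∀ x ∈ A.deg p, ∀ y ∈ A.deg q, S x y = T x y) (x y : A.carrier) :
    S x y = T x y := by
  have hx : x ∈ ⨆ g, A.deg g := A.deg_iSup ▸ Submodule.mem_top
  have hy : y ∈ ⨆ g, A.deg g := A.deg_iSup ▸ Submodule.mem_top
  induction hx using Submodule.iSup_induction' with
  | zero => simp
  | add a b _ _ ha hb => simp [ha, hb]
  | mem p a ha =>
    induction hy using Submodule.iSup_induction' with
    | zero => simp
    | add b c _ _ hb hc => simp [hb, hc]
    | mem q b hb => exact h p q a ha b hb

/-- Constructor of morphisms from a linear bijection that is multiplicative up to the twist. -/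
def ExtHom.ofHomogeneous {A A' : ExtObj.{u, v, w} π ξ hξ} (lam : π.ker →* ℝˣ)
    (e : A.alg.carrier ≃ₗ[ℝ] A'.alg.carrier)
    (hmul : ∀ p q, ∀ x ∈ A.alg.deg p, ∀ y ∈ A.alg.deg q,
      (lam (cocycle π ξ hξ p q) : ℝ) • e (x * y) = e x * e y)
    (hmem : ∀ p x, e x ∈ A'.alg.deg p ↔ x ∈ A.alg.deg p) : ExtHom π ξ hξ A A' where
  char := lam
  iso :=
    { toLinearEquiv := e
      map_mul := fun x y => GrAlg.bilin_ext (A := A.alg)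
        ((A.alg.twistMul (fun p q => (lam (cocycle π ξ hξ p q) : ℝ))).compr₂ e.toLinearMap)
        ((LinearMap.mul ℝ A'.alg.carrier).compl₁₂ e.toLinearMap e.toLinearMap)
        (fun p q x hx y hy => by
          simpa [A.alg.twistMul_of_mem _ hx hy] using hmul p q x hx y hy) x y
      map_mem_iff := hmem }

/-- The linear bijection underlying a morphism. -/
def ExtHom.equiv {A A' : ExtObj.{u, v, w} π ξ hξ} (f : ExtHom π ξ hξ A A') :
    A.alg.carrier ≃ₗ[ℝ] A'.alg.carrier :=
  f.iso.toLinearEquiv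

theorem ExtHom.ext' {A A' : ExtObj.{u, v, w} π ξ hξ} {f g : ExtHom π ξ hξ A A'}
    (hc : f.char = g.char) (he : ∀ x, f.equiv x = g.equiv x) : f = g := by
  obtain ⟨l, e, _, _⟩ := f
  obtain ⟨l', e', _, _⟩ := g
  obtain rfl : l = l' := hc
  obtain rfl : e = e' := LinearEquiv.ext he
  rfl

theorem ExtHom.equiv_mul {A A' : ExtObj.{u, v, w} π ξ hξ} (f : ExtHom π ξ hξ A A')
    {p q : Gbar} {x y : A.alg.carrier} (hx : x ∈ A.alg.deg p) (hy : y ∈ A.alg.deg q) :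
    (f.char (cocycle π ξ hξ p q) : ℝ) • f.equiv (x * y) = f.equiv x * f.equiv y := by
  have h : f.equiv (A.alg.twistMul (fun p q => (f.char (cocycle π ξ hξ p q) : ℝ)) x y) =
      f.equiv x * f.equiv y := f.iso.map_mul x y
  rwa [A.alg.twistMul_of_mem _ hx hy, map_smul] at h

theorem ExtHom.equiv_mem_iff {A A' : ExtObj.{u, v, w} π ξ hξ} (f : ExtHom π ξ hξ A A')
    (p : Gbar) (x : A.alg.carrier) : f.equiv x ∈ A'.alg.deg p ↔ x ∈ A.alg.deg p :=
  f.iso.map_mem_iff p x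

/-- The identity morphism `(id, 1)`. -/
def ExtHom.idHom (A : ExtObj.{u, v, w} π ξ hξ) : ExtHom π ξ hξ A A :=
  ExtHom.ofHomogeneous 1 (LinearEquiv.refl ℝ A.alg.carrier) (by simp) (by simp)

/-- The composition `(ψ', lam') (ψ, lam) = (ψ' ψ, lam' lam)`. -/
def ExtHom.compHom {A B C : ExtObj.{u, v, w} π ξ hξ} (f : ExtHom π ξ hξ A B)
    (g : ExtHom π ξ hξ B C) : ExtHom π ξ hξ A C :=
  ExtHom.ofHomogeneous (g.char * f.char) (f.equiv.trans g.equiv)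
    (fun p q x hx y hy => by
      simp only [LinearEquiv.trans_apply]
      rw [← g.equiv_mul ((f.equiv_mem_iff _ _).2 hx) ((f.equiv_mem_iff _ _).2 hy),
        ← f.equiv_mul hx hy, map_smul, smul_smul, MonoidHom.mul_apply, Units.val_mul])
    (fun p x => (g.equiv_mem_iff p _).trans (f.equiv_mem_iff p x))

/-- The inverse `(ψ⁻¹, lam⁻¹)` of `(ψ, lam)`. -/
def ExtHom.invHom {A B : ExtObj.{u, v, w} π ξ hξ} (f : ExtHom π ξ hξ A B) :
    ExtHom π ξ hξ B A :=
  ExtHom.ofHomogeneous f.char⁻¹ f.equiv.symm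
    (fun p q x hx y hy => by
      obtain ⟨a, rfl⟩ := f.equiv.surjective x
      obtain ⟨b, rfl⟩ := f.equiv.surjective y
      rw [← f.equiv_mul ((f.equiv_mem_iff _ _).1 hx) ((f.equiv_mem_iff _ _).1 hy), map_smul,
        LinearEquiv.symm_apply_apply, LinearEquiv.symm_apply_apply,
        LinearEquiv.symm_apply_apply, smul_smul, MonoidHom.inv_apply, Units.inv_mul, one_smul])
    (fun p x => by rw [← f.equiv_mem_iff]; simp)

/-- The extended groupoid. -/
instance ExtObj.groupoid : Groupoid (ExtObj.{u, v, w} π ξ hξ) where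
  Hom A A' := ExtHom π ξ hξ A A'
  id A := ExtHom.idHom A
  comp f g := ExtHom.compHom f g
  inv f := ExtHom.invHom f
  id_comp f := ExtHom.ext' (mul_one (ExtHom.char f)) fun _ => rfl
  comp_id f := ExtHom.ext' (one_mul (ExtHom.char f)) fun _ => rfl
  assoc f g h := ExtHom.ext'
    (mul_assoc (ExtHom.char h) (ExtHom.char g) (ExtHom.char f)).symm fun _ => rfl
  inv_comp f := ExtHom.ext' (mul_inv_cancel (ExtHom.char f))
    fun x => (ExtHom.equiv f).apply_symm_apply x
  comp_inv f := ExtHom.ext' (inv_mul_cancel (ExtHom.char f))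
    fun x => (ExtHom.equiv f).symm_apply_apply x

end Twist

/-! ### Loop algebras -/

section Loop

variable {G : Type u} {Gbar : Type v} [CommGroup G] [CommGroup Gbar] (π : G →* Gbar)
  (χ : G →* Circle)

/-- The involution `z ⊗ g ↦ conj z * χ(g) ⊗ g` of the complex group algebra of `G`, i.e. the
action of the generator of `Gal(ℂ/ℝ)`. -/
noncomputable def galois : MonoidAlgebra ℂ G →ₐ[ℝ] MonoidAlgebra ℂ G :=
  MonoidAlgebra.liftNCAlgHom
    ((MonoidAlgebra.singleOneAlgHom (R := ℝ) (A := ℂ) (M := G)).comp Complex.conjAe.toAlgHom)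
    { toFun := fun g => MonoidAlgebra.single g (χ g : ℂ)
      map_one' := by simp [MonoidAlgebra.one_def]
      map_mul' := fun g h => by simp [MonoidAlgebra.single_mul_single] }
    (fun _ _ => mul_comm _ _)

theorem galois_single (g : G) (z : ℂ) :
    galois χ (MonoidAlgebra.single g z) = MonoidAlgebra.single g (starRingEnd ℂ z * χ g) := by
  change MonoidAlgebra.liftNC _ _ _ = _
  rw [MonoidAlgebra.liftNC_single]
  simp [MonoidAlgebra.single_mul_single]

variable (A : GrAlg.{v, w} Gbar)

/-- The algebra `A ⊗ ℂG = A ⊗ ℂ ⊗ ℝG` in which the loop algebras live. -/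
abbrev Ambient : Type max u w := A.carrier ⊗[ℝ] MonoidAlgebra ℂ G

/-- The action of the generator of `Gal(ℂ/ℝ)`: `a ⊗ z ⊗ g ↦ a ⊗ conj z * χ(g) ⊗ g`. -/
noncomputable def ambGalois : Ambient (G := G) A →ₗ[ℝ] Ambient (G := G) A :=
  TensorProduct.map LinearMap.id (galois χ).toLinearMap

/-- The component `A_{π(g)} ⊗ ℂ ⊗ g` of the complex loop algebra `L_π(A ⊗ ℂ)`. -/
noncomputable def complexLoopDeg (g : G) : Submodule ℝ (Ambient (G := G) A) :=
  Submodule.span ℝ {t | ∃ a ∈ A.deg (π g), ∃ z : ℂ, t = a ⊗ₜ[ℝ] MonoidAlgebra.single g z}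

theorem ambGalois_mul (x y : Ambient (G := G) A) :
    ambGalois χ A (x * y) = ambGalois χ A x * ambGalois χ A y := by
  induction x using TensorProduct.induction_on with
  | zero => simp
  | add a b ha hb => simp [add_mul, ha, hb]
  | tmul a s =>
    induction y using TensorProduct.induction_on with
    | zero => simp
    | add b c hb hc => simp only [mul_add, map_add, hb, hc]
    | tmul b t => simp [ambGalois]

theorem complexLoopDeg_mul {g h : G} {x y : Ambient (G := G) A}
    (hx : x ∈ complexLoopDeg π A g) (hy : y ∈ complexLoopDeg π A h) :
    x * y ∈ complexLoopDeg π A (g * h) := by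
  induction hx using Submodule.span_induction with
  | zero => simp
  | add a b _ _ ha hb => rw [add_mul]; exact add_mem ha hb
  | smul r a _ ha => rw [smul_mul_assoc]; exact Submodule.smul_mem _ r ha
  | mem a ha =>
    obtain ⟨a, ha, z, rfl⟩ := ha
    induction hy using Submodule.span_induction with
    | zero => simp
    | add a b _ _ ha hb => rw [mul_add]; exact add_mem ha hb
    | smul r a _ ha => rw [mul_smul_comm]; exact Submodule.smul_mem _ r ha
    | mem b hb =>
      obtain ⟨b, hb, t, rfl⟩ := hb
      rw [Algebra.TensorProduct.tmul_mul_tmul, MonoidAlgebra.single_mul_single]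
      exact Submodule.subset_span ⟨a * b, map_mul π g h ▸ A.mul_mem ha hb, z * t, rfl⟩

theorem complexLoop_mul {x y : Ambient (G := G) A}
    (hx : x ∈ ⨆ g, complexLoopDeg π A g) (hy : y ∈ ⨆ g, complexLoopDeg π A g) :
    x * y ∈ ⨆ g, complexLoopDeg π A g := by
  induction hx using Submodule.iSup_induction' with
  | zero => simp
  | add a b _ _ ha hb => rw [add_mul]; exact add_mem ha hb
  | mem g a ha =>
    induction hy using Submodule.iSup_induction' with
    | zero => simp
    | add a b _ _ ha hb => rw [mul_add]; exact add_mem ha hb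
    | mem h b hb =>
      exact Submodule.mem_iSup_of_mem (g * h) (complexLoopDeg_mul π A ha hb)

/-- The real loop algebra `L_π^χ(A)`: the fixed points of the Galois action in the complex loop
algebra `L_π(A ⊗ ℂ) = ⨁_g A_{π(g)} ⊗ ℂ ⊗ g`. -/
noncomputable def loopSubalgebra : NonUnitalSubalgebra ℝ (Ambient (G := G) A) where
  carrier := {x | x ∈ (⨆ g, complexLoopDeg π A g) ∧ ambGalois χ A x = x}
  mul_mem' hx hy := ⟨complexLoop_mul π A hx.1 hy.1, by rw [ambGalois_mul, hx.2, hy.2]⟩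
  add_mem' hx hy := ⟨add_mem hx.1 hy.1, by rw [map_add, hx.2, hy.2]⟩
  zero_mem' := ⟨zero_mem _, map_zero _⟩
  smul_mem' r x hx := ⟨Submodule.smul_mem _ r hx.1, by rw [map_smul, hx.2]⟩

/-- The homogeneous component of degree `g` of the real loop algebra. -/
noncomputable def loopDeg (g : G) : Submodule ℝ (loopSubalgebra π χ A) :=
  (complexLoopDeg π A g).comap (NonUnitalSubalgebra.toSubmodule (loopSubalgebra π χ A)).subtype

/-- The projection of `A ⊗ ℂG` onto `A ⊗ ℂ ⊗ g`. -/
noncomputable def ambProj (g : G) : Ambient (G := G) A →ₗ[ℝ] Ambient (G := G) A :=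
  TensorProduct.map LinearMap.id
    (MonoidAlgebra.lsingle g ∘ₗ Finsupp.lapply g ∘ₗ
      (MonoidAlgebra.coeffLinearEquiv (S := ℂ) (M := G) ℝ).toLinearMap)

theorem ambProj_same {g : G} {x : Ambient (G := G) A} (hx : x ∈ complexLoopDeg π A g) :
    ambProj A g x = x := by
  induction hx using Submodule.span_induction with
  | zero => simp
  | add a b _ _ ha hb => rw [map_add, ha, hb]
  | smul r a _ ha => rw [map_smul, ha]
  | mem a ha =>
    obtain ⟨a, ha, z, rfl⟩ := ha
    simp [ambProj]

theorem ambProj_ne {g h : G} (hgh : h ≠ g) {x : Ambient (G := G) A}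
    (hx : x ∈ complexLoopDeg π A h) : ambProj A g x = 0 := by
  induction hx using Submodule.span_induction with
  | zero => simp
  | add a b _ _ ha hb => rw [map_add, ha, hb, add_zero]
  | smul r a _ ha => rw [map_smul, ha, smul_zero]
  | mem a ha =>
    obtain ⟨a, ha, z, rfl⟩ := ha
    simp [ambProj, hgh]

theorem ambGalois_mem {g : G} {x : Ambient (G := G) A} (hx : x ∈ complexLoopDeg π A g) :
    ambGalois χ A x ∈ complexLoopDeg π A g := by
  induction hx using Submodule.span_induction with
  | zero => simp
  | add a b _ _ ha hb => rw [map_add]; exact add_mem ha hb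
  | smul r a _ ha => rw [map_smul]; exact Submodule.smul_mem _ r ha
  | mem a ha =>
    obtain ⟨a, ha, z, rfl⟩ := ha
    refine Submodule.subset_span ⟨a, ha, starRingEnd ℂ z * χ g, ?_⟩
    simp [ambGalois, galois_single]

theorem complexLoopDeg_indep : iSupIndep (complexLoopDeg (G := G) π A) := by
  intro g
  rw [Submodule.disjoint_def]
  intro x hx hx'
  rw [← ambProj_same π A hx]
  have : (⨆ (j : G) (_ : j ≠ g), complexLoopDeg π A j) ≤ LinearMap.ker (ambProj A g) :=
    iSup₂_le fun j hj y hy => ambProj_ne π A hj hy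
  exact this hx'

theorem loopDeg_indep : iSupIndep (loopDeg π χ A) := by
  intro g
  rw [Submodule.disjoint_def]
  intro x hx hx'
  have key := (Submodule.disjoint_def.1 (complexLoopDeg_indep π A g)) (x : Ambient (G := G) A) hx
  refine Subtype.ext (key ?_)
  have : (⨆ (j : G) (_ : j ≠ g), loopDeg π χ A j) ≤
      (⨆ (j : G) (_ : j ≠ g), complexLoopDeg π A j).comap
        (NonUnitalSubalgebra.toSubmodule (loopSubalgebra π χ A)).subtype :=
    iSup₂_le fun j hj y hy => Submodule.mem_iSup_of_mem j (Submodule.mem_iSup_of_mem hj hy)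
  exact this hx'

theorem loopDeg_iSup : ⨆ g, loopDeg π χ A g = ⊤ := by
  classical
  rw [eq_top_iff]
  rintro ⟨x, hx, hfix⟩ -
  obtain ⟨f, hf, hsum⟩ := (Submodule.mem_iSup_iff_exists_finsupp _ _).1 hx
  have hfixf : ∀ g, ambGalois χ A (f g) = f g := by
    intro g
    have e1 : ambProj A g x = f g := by
      rw [← hsum, Finsupp.sum, map_sum]
      rw [Finset.sum_eq_single g]
      · exact ambProj_same π A (hf g)
      · intro h _ hne; exact ambProj_ne π A hne (hf h)
      · intro hg; simp [Finsupp.notMem_support_iff.1 hg]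
    have e2 : ambProj A g (ambGalois χ A x) = ambGalois χ A (f g) := by
      rw [← hsum, Finsupp.sum, map_sum, map_sum]
      rw [Finset.sum_eq_single g]
      · exact ambProj_same π A (ambGalois_mem π χ A (hf g))
      · intro h _ hne; exact ambProj_ne π A hne (ambGalois_mem π χ A (hf h))
      · intro hg; simp [Finsupp.notMem_support_iff.1 hg]
    rw [← e2, hfix, e1]
  have hmem : ∀ g, f g ∈ loopSubalgebra π χ A := fun g =>
    ⟨Submodule.mem_iSup_of_mem g (hf g), hfixf g⟩
  have : (⟨x, hx, hfix⟩ : loopSubalgebra π χ A) = ∑ g ∈ f.support, ⟨f g, hmem g⟩ :=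
    Subtype.ext (hsum.symm.trans
      (map_sum (NonUnitalSubalgebra.toSubmodule (loopSubalgebra π χ A)).subtype
        (fun g => (⟨f g, hmem g⟩ : loopSubalgebra π χ A)) f.support).symm)
  rw [this]
  exact sum_mem fun g _ => Submodule.mem_iSup_of_mem g (hf g)

/-- The real loop algebra `L_π^χ(A)` as a `G`-graded algebra. -/
noncomputable def loop : GrAlg.{u, max u w} G where
  carrier := loopSubalgebra π χ A
  deg := loopDeg π χ A
  deg_indep := loopDeg_indep π χ A
  deg_iSup := loopDeg_iSup π χ A
  mul_mem := fun hx hy => complexLoopDeg_mul π A hx hy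

/-- The linear operator `z ⊗ g ↦ s(g) z ⊗ g` of the complex group algebra. -/
noncomputable def groupScale (s : G → ℝ) : MonoidAlgebra ℂ G →ₗ[ℝ] MonoidAlgebra ℂ G :=
  Finsupp.lsum ℝ (fun g => s g • MonoidAlgebra.lsingle g) ∘ₗ
    (MonoidAlgebra.coeffLinearEquiv (S := ℂ) (M := G) ℝ).toLinearMap

theorem groupScale_single (s : G → ℝ) (g : G) (z : ℂ) :
    groupScale s (MonoidAlgebra.single g z) = s g • MonoidAlgebra.single g z := by
  simp [groupScale]

end Loop

/-! ### The extended loop functor -/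

section Functor

variable {G : Type u} {Gbar : Type v} [CommGroup G] [CommGroup Gbar] (π : G →* Gbar)
  (χ : G →* Circle) {ξ : Gbar → G} {hξ : Function.RightInverse ξ π}

/-- The map `a ⊗ z ⊗ g ↦ ψ(a) ⊗ lam(g ξ(π(g))⁻¹) z ⊗ g` on `A ⊗ ℂG`, for a morphism
`(ψ, lam)`. On the real loop algebra this is `a ⊗ u ↦ lam(g ξ(π(g))⁻¹) ψ(a) ⊗ u`, for `a` of
degree `π(g)` and `u = z ⊗ g` with `conj z * χ(g) = z`. -/
noncomputable def ambMap {A A' : ExtObj.{u, v, w} π ξ hξ} (f : A ⟶ A') :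
    Ambient (G := G) A.alg →ₗ[ℝ] Ambient (G := G) A'.alg :=
  TensorProduct.map (ExtHom.equiv f).toLinearMap
    (groupScale fun g => (ExtHom.char f (kerPart π ξ hξ g) : ℝ))

theorem ambMap_tmul_single {A A' : ExtObj.{u, v, w} π ξ hξ} (f : A ⟶ A') (a : A.alg.carrier)
    (g : G) (z : ℂ) : ambMap π f (a ⊗ₜ MonoidAlgebra.single g z) =
      (ExtHom.char f (kerPart π ξ hξ g) : ℝ) •
        (ExtHom.equiv f a ⊗ₜ[ℝ] MonoidAlgebra.single g z) := by
  rw [ambMap, TensorProduct.map_tmul, groupScale_single, TensorProduct.tmul_smul]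
  rfl

/-- Linear maps out of `A ⊗ ℂG` are determined on the tensors `a ⊗ z ⊗ g`. -/
theorem amb_hom_ext {G : Type u} {A : GrAlg.{v, w} Gbar} {M : Type*} [AddCommGroup M] [Module ℝ M]
    {S T : Ambient (G := G) A →ₗ[ℝ] M}
    (h : ∀ a g z, S (a ⊗ₜ MonoidAlgebra.single g z) = T (a ⊗ₜ MonoidAlgebra.single g z)) :
    S = T := by
  refine TensorProduct.ext (LinearMap.ext fun a => MonoidAlgebra.lhom_ext' fun g => ?_)
  exact LinearMap.ext fun z => h a g z

theorem ambMap_id (A : ExtObj.{u, v, w} π ξ hξ) : ambMap π (𝟙 A) = LinearMap.id :=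
  amb_hom_ext fun a g z => by
    rw [ambMap_tmul_single]
    change ((1 : ℝˣ) : ℝ) • (a ⊗ₜ[ℝ] MonoidAlgebra.single g z) = _
    simp

theorem ambMap_comp {A B C : ExtObj.{u, v, w} π ξ hξ} (f : A ⟶ B) (g : B ⟶ C) :
    ambMap π (f ≫ g) = ambMap π g ∘ₗ ambMap π f :=
  amb_hom_ext fun a k z => by
    rw [LinearMap.comp_apply, ambMap_tmul_single, ambMap_tmul_single, map_smul,
      ambMap_tmul_single, smul_smul, mul_comm]
    rfl

theorem ambMap_mem {A A' : ExtObj.{u, v, w} π ξ hξ} (f : A ⟶ A') {g : G}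
    {x : Ambient (G := G) A.alg} (hx : x ∈ complexLoopDeg π A.alg g) :
    ambMap π f x ∈ complexLoopDeg π A'.alg g := by
  induction hx using Submodule.span_induction with
  | zero => simp
  | add a b _ _ ha hb => rw [map_add]; exact add_mem ha hb
  | smul r a _ ha => rw [map_smul]; exact Submodule.smul_mem _ r ha
  | mem a ha =>
    obtain ⟨a, ha, z, rfl⟩ := ha
    rw [ambMap_tmul_single]
    exact Submodule.smul_mem _ _
      (Submodule.subset_span ⟨_, (ExtHom.equiv_mem_iff f _ _).2 ha, z, rfl⟩)

theorem ambMap_galois {A A' : ExtObj.{u, v, w} π ξ hξ} (f : A ⟶ A')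
    (x : Ambient (G := G) A.alg) :
    ambMap π f (ambGalois χ A.alg x) = ambGalois χ A'.alg (ambMap π f x) := by
  have : ambMap π f ∘ₗ ambGalois χ A.alg = ambGalois χ A'.alg ∘ₗ ambMap π f :=
    amb_hom_ext fun a g z => by
      simp [ambGalois, galois_single, ambMap_tmul_single]
  exact LinearMap.congr_fun this x

theorem ambMap_mem_loop {A A' : ExtObj.{u, v, w} π ξ hξ} (f : A ⟶ A')
    {x : Ambient (G := G) A.alg} (hx : x ∈ loopSubalgebra π χ A.alg) :
    ambMap π f x ∈ loopSubalgebra π χ A'.alg := by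
  refine ⟨?_, by rw [← ambMap_galois, hx.2]⟩
  have : (⨆ g, complexLoopDeg π A.alg g) ≤
      (⨆ g, complexLoopDeg π A'.alg g).comap (ambMap π f) :=
    iSup_le fun g y hy => Submodule.mem_iSup_of_mem g (ambMap_mem π f hy)
  exact this hx.1

theorem ambMap_mul_of_mem {A A' : ExtObj.{u, v, w} π ξ hξ} (f : A ⟶ A') {g h : G}
    {x y : Ambient (G := G) A.alg}
    (hx : x ∈ complexLoopDeg π A.alg g) (hy : y ∈ complexLoopDeg π A.alg h) :
    ambMap π f (x * y) = ambMap π f x * ambMap π f y := by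
  induction hx using Submodule.span_induction with
  | zero => simp
  | add a b _ _ ha hb => simp only [add_mul, map_add, ha, hb]
  | smul r a _ ha => simp only [smul_mul_assoc, map_smul, ha]
  | mem a ha =>
    obtain ⟨a, ha, z, rfl⟩ := ha
    induction hy using Submodule.span_induction with
    | zero => simp
    | add a b _ _ ha hb => simp only [mul_add, map_add, ha, hb]
    | smul r a _ ha => simp only [mul_smul_comm, map_smul, ha]
    | mem b hb =>
      obtain ⟨b, hb, t, rfl⟩ := hb
      have hk : kerPart π ξ hξ (g * h) =
          kerPart π ξ hξ g * kerPart π ξ hξ h * cocycle π ξ hξ (π g) (π h) := by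
        apply Subtype.ext
        simp only [kerPart, cocycle, Subgroup.coe_mul, map_mul]
        have : ∀ a b c d e : G, a * b * e⁻¹ = a * c⁻¹ * (b * d⁻¹) * (c * d * e⁻¹) := by
          intro a b c d e
          rw [mul_mul_mul_comm a c⁻¹ b d⁻¹, ← mul_inv, mul_assoc (a * b) (c * d)⁻¹,
            inv_mul_cancel_left]
        exact this _ _ _ _ _
      simp only [Algebra.TensorProduct.tmul_mul_tmul, MonoidAlgebra.single_mul_single,
        ambMap_tmul_single, smul_mul_smul_comm, ← ExtHom.equiv_mul f ha hb, hk, map_mul,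
        Units.val_mul]
      rw [← TensorProduct.smul_tmul', smul_smul]

theorem ambMap_mul {A A' : ExtObj.{u, v, w} π ξ hξ} (f : A ⟶ A')
    {x y : Ambient (G := G) A.alg}
    (hx : x ∈ ⨆ g, complexLoopDeg π A.alg g) (hy : y ∈ ⨆ g, complexLoopDeg π A.alg g) :
    ambMap π f (x * y) = ambMap π f x * ambMap π f y := by
  induction hx using Submodule.iSup_induction' with
  | zero => simp
  | add a b _ _ ha hb => simp only [add_mul, map_add, ha, hb]
  | mem g a ha =>
    induction hy using Submodule.iSup_induction' with
    | zero => simp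
    | add a b _ _ ha hb => simp only [mul_add, map_add, ha, hb]
    | mem h b hb => exact ambMap_mul_of_mem π f ha hb

theorem ambMap_inv_apply {A A' : ExtObj.{u, v, w} π ξ hξ} (f : A ⟶ A')
    (x : Ambient (G := G) A.alg) : ambMap π (Groupoid.inv f) (ambMap π f x) = x := by
  rw [← LinearMap.comp_apply, ← ambMap_comp, Groupoid.comp_inv, ambMap_id, LinearMap.id_apply]

theorem ambMap_apply_inv {A A' : ExtObj.{u, v, w} π ξ hξ} (f : A ⟶ A')
    (x : Ambient (G := G) A'.alg) : ambMap π f (ambMap π (Groupoid.inv f) x) = x := by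
  rw [← LinearMap.comp_apply, ← ambMap_comp, Groupoid.inv_comp, ambMap_id, LinearMap.id_apply]

/-- The isomorphism of loop algebras attached to a morphism `(ψ, lam)`: the restriction of
`ambMap`. -/
noncomputable def loopMap {A A' : ExtObj.{u, v, w} π ξ hξ} (f : A ⟶ A') :
    GradedEquiv (loop π χ A.alg).deg (loop π χ A'.alg).deg where
  toLinearEquiv :=
    { toFun := fun x => ⟨ambMap π f x.1, ambMap_mem_loop π χ f x.2⟩
      invFun := fun x => ⟨ambMap π (Groupoid.inv f) x.1, ambMap_mem_loop π χ _ x.2⟩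
      map_add' := fun x y => Subtype.ext (map_add (ambMap π f) x.1 y.1)
      map_smul' := fun r x => Subtype.ext (map_smul (ambMap π f) r x.1)
      left_inv := fun x => Subtype.ext (ambMap_inv_apply π f x.1)
      right_inv := fun x => Subtype.ext (ambMap_apply_inv π f x.1) }
  map_mul := fun x y => Subtype.ext (ambMap_mul π f x.2.1 y.2.1)
  map_mem_iff := fun g x =>
    ⟨fun hx => by
      have := ambMap_mem π (Groupoid.inv f) (g := g) (x := ambMap π f x.1) hx
      rw [ambMap_inv_apply] at this
      exact this,
    fun hx => ambMap_mem π f (g := g) (x := x.1) hx⟩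

theorem GradedEquiv.ext' {G A B : Type*}
    [NonUnitalNonAssocSemiring A] [Module ℝ A] [NonUnitalNonAssocSemiring B] [Module ℝ B]
    {𝒜 : G → Submodule ℝ A} {ℬ : G → Submodule ℝ B} {f g : GradedEquiv 𝒜 ℬ}
    (h : ∀ x, f.toLinearEquiv x = g.toLinearEquiv x) : f = g := by
  obtain ⟨e, _, _⟩ := f
  obtain ⟨e', _, _⟩ := g
  obtain rfl : e = e' := LinearEquiv.ext h
  rfl

variable (ξ hξ) in
/-- The extended loop functor, as a functor to all `G`-graded algebras and their graded
isomorphisms. -/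
noncomputable def extLoopFunctor :
    ExtObj.{u, v, w} π ξ hξ ⥤ GrAlg.{u, max u w} G where
  obj A := loop π χ A.alg
  map f := loopMap π χ f
  map_id A := GradedEquiv.ext' fun x => Subtype.ext (LinearMap.congr_fun (ambMap_id π A) x.1)
  map_comp f g := GradedEquiv.ext' fun x =>
    Subtype.ext (LinearMap.congr_fun (ambMap_comp π f g) x.1)

/-- The property defining the objects of the target groupoid: `B` is graded-simple and its
centroid is isomorphic, as a `G`-graded algebra, to `L_π^χ(ℝ)`, where `ℝ` is trivially graded. -/
def HasLoopCentroid : ObjectProperty (GrAlg.{u, w} G) := fun B =>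
  B.IsGradedSimple ∧
    Nonempty (GradedEquiv (loop π χ (GrAlg.trivialReal Gbar)).deg B.centroidDeg)

/-- The target groupoid: graded-simple `G`-graded algebras with centroid `L_π^χ(ℝ)` and their
graded isomorphisms. -/
abbrev LoopTarget := (HasLoopCentroid.{u, v, w} π χ).FullSubcategory

instance LoopTarget.groupoid : Groupoid (LoopTarget.{u, v, w} π χ) where
  inv f := ObjectProperty.homMk (Groupoid.inv f.hom)
  inv_comp f := ObjectProperty.hom_ext _ (Groupoid.inv_comp f.hom)
  comp_inv f := ObjectProperty.hom_ext _ (Groupoid.comp_inv f.hom)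

end Functor

end LoopGr

/-! Choose for every g a complex number z_g ≠ 0 with z_g / conj z_g = χ(g) and put u_g = z_g ⊗ g.
Since χ is multiplicative, z_g z_h / z_{gh} is invariant under conjugation, so u_g u_h = c(g, h)
u_{gh} with c a symmetric 2-cocycle (`loopCocycle`) of nonzero real numbers. The loop algebra of A
is then the sum of the spaces A_{π(g)} ⊗ u_g with (a ⊗ u_g)(b ⊗ u_h) = c(g, h) ab ⊗ u_{gh}
(`loopι_mul`), and from there on only c matters.

The functor lands in the target (`hasLoopCentroid_loop`). A centroid element of degree g acts by a ⊗
u_k ↦ c(g, k) F_k(a) ⊗ u_{gk}. As nothing nonzero annihilates A, F_k depends only on π(k) and comes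
from a centroid element of A of degree π(g) (`exists_centroidLift`). Centrality of A leaves the real
multiples of u_g for g in H = ker π and 0 otherwise, which is the loop algebra of ℝ. A graded ideal
of the loop algebra is compared with the ideal of those a all of whose lifts a ⊗ u_g it contains
(`isGradedSimple_loop`).

Full faithfulness. A graded isomorphism has the form a ⊗ u_k ↦ φ_k(a) ⊗ u_k. It conjugates the
action of u_h, for h in H, into a centroid element of degree h, hence into a real multiple of u_h,
so φ_{hk} = lam(h) φ_k (`exists_char`). The maps φ_{ξ(p)} assemble to ψ, and the identity ξ(p) ξ(q)
= σ(p, q) ξ(pq) turns multiplicativity of φ into twisted multiplicativity of ψ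
(`exists_loopMap_eq`). Evaluating at ξ(p) and at h ξ(p) recovers ψ and lam (`loopMap_injective`).

Essential surjectivity (`exists_loop_equiv`). Dividing the product of B by c, and the action on B of
the centroid elements corresponding to u_h by c as well, yields a genuine action of H compatible
with the new product. The quotient A, realized on the sum of the B_{ξ(p)}, has B as its loop algebra
(`IsKernelAction.loopEquiv`). That A is graded-simple and central can be read off from B. It is then
simple by a minimal support argument (`IsGradedSimple.isCentralSimple`). -/

namespace LoopGr

namespace GrAlg

/-! ### Homogeneous components -/

variable {G : Type u} [CommGroup G] {M : Type*} [AddCommGroup M] [Module ℝ M]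

theorem homogeneous_induction {A : GrAlg.{u, w} G} {P : A.carrier → Prop} (zero : P 0)
    (add : ∀ x y, P x → P y → P (x + y)) (mem : ∀ g, ∀ x ∈ A.deg g, P x) (x : A.carrier) :
    P x :=
  Submodule.iSup_induction A.deg (motive := P) (A.deg_iSup ▸ Submodule.mem_top) mem zero add

theorem hom_ext {A : GrAlg.{u, w} G} {S T : A.carrier →ₗ[ℝ] M}
    (h : ∀ g, ∀ x ∈ A.deg g, S x = T x) : S = T :=
  LinearMap.ext <| homogeneous_induction (by simp) (fun x y hx hy => by simp [hx, hy]) h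

open scoped Classical in
/-- The linear map given by `f g` on the component of degree `g`. -/
noncomputable def lift (A : GrAlg.{u, w} G) (f : G → A.carrier →ₗ[ℝ] M) : A.carrier →ₗ[ℝ] M :=
  DirectSum.toModule ℝ G M (fun g => f g ∘ₗ (A.deg g).subtype) ∘ₗ A.decomp.toLinearMap

theorem lift_of_mem (A : GrAlg.{u, w} G) (f : G → A.carrier →ₗ[ℝ] M) {g : G} {x : A.carrier}
    (hx : x ∈ A.deg g) : A.lift f x = f g x := by
  classical
  simp [lift, decomp_of_mem A hx, DirectSum.toModule_lof]

open scoped Classical in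
/-- The projection onto the component of degree `g`. -/
noncomputable def proj (A : GrAlg.{u, w} G) (g : G) : A.carrier →ₗ[ℝ] A.carrier :=
  A.lift fun h => if h = g then LinearMap.id else 0

theorem proj_of_mem (A : GrAlg.{u, w} G) {g : G} {x : A.carrier} (hx : x ∈ A.deg g) :
    A.proj g x = x := by
  simp [proj, lift_of_mem A _ hx]

theorem proj_of_mem_ne (A : GrAlg.{u, w} G) {g h : G} {x : A.carrier} (hx : x ∈ A.deg h)
    (hne : h ≠ g) : A.proj g x = 0 := by
  simp [proj, lift_of_mem A _ hx, hne]

theorem proj_mem (A : GrAlg.{u, w} G) (g : G) (x : A.carrier) : A.proj g x ∈ A.deg g := by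
  induction x using homogeneous_induction with
  | zero => simp
  | add x y hx hy => rw [map_add]; exact add_mem hx hy
  | mem h x hx =>
    by_cases hg : h = g
    · subst hg; rwa [proj_of_mem A hx]
    · rw [proj_of_mem_ne A hx hg]; exact zero_mem _

theorem exists_sum_proj (A : GrAlg.{u, w} G) (x : A.carrier) :
    ∃ S : Finset G, (∀ g ∉ S, A.proj g x = 0) ∧ ∑ g ∈ S, A.proj g x = x := by
  classical
  induction x using homogeneous_induction with
  | zero => exact ⟨∅, by simp, by simp⟩
  | add x y hx hy =>
    obtain ⟨S, hS, hx⟩ := hx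
    obtain ⟨T, hT, hy⟩ := hy
    refine ⟨S ∪ T, fun g hg => ?_, ?_⟩
    · rw [Finset.mem_union, not_or] at hg
      rw [map_add, hS g hg.1, hT g hg.2, add_zero]
    · simp only [map_add, Finset.sum_add_distrib]
      rw [← Finset.sum_subset Finset.subset_union_left fun g _ hg => hS g hg,
        ← Finset.sum_subset Finset.subset_union_right fun g _ hg => hT g hg, hx, hy]
  | mem h x hx =>
    exact ⟨{h}, fun g hg => proj_of_mem_ne A hx fun e => hg (by simp [e]),
      by simp [proj_of_mem A hx]⟩

theorem eq_zero_of_proj {A : GrAlg.{u, w} G} {x : A.carrier} (h : ∀ g, A.proj g x = 0) :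
    x = 0 := by
  obtain ⟨S, -, hx⟩ := A.exists_sum_proj x
  rw [← hx, Finset.sum_eq_zero fun g _ => h g]

theorem mem_of_proj {A : GrAlg.{u, w} G} {I : Submodule ℝ A.carrier} {x : A.carrier}
    (h : ∀ g, A.proj g x ∈ I) : x ∈ I := by
  obtain ⟨S, -, hx⟩ := A.exists_sum_proj x
  rw [← hx]
  exact sum_mem fun g _ => h g

theorem mem_deg_of_proj {A : GrAlg.{u, w} G} {g : G} {x : A.carrier}
    (h : ∀ k, k ≠ g → A.proj k x = 0) : x ∈ A.deg g :=
  mem_of_proj fun k => by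
    by_cases hk : k = g
    · subst hk; exact A.proj_mem k x
    · rw [h k hk]; exact zero_mem _

theorem eq_of_mem_of_mem {A : GrAlg.{u, w} G} {g h : G} {x : A.carrier} (hx : x ∈ A.deg g)
    (hx' : x ∈ A.deg h) (h0 : x ≠ 0) : g = h := by
  by_contra hne
  exact h0 (by rw [← proj_of_mem A hx', proj_of_mem_ne A hx hne])

theorem proj_mul_left (A : GrAlg.{u, w} G) {q : G} {a : A.carrier} (ha : a ∈ A.deg q) (p : G)
    (x : A.carrier) : A.proj p (a * x) = a * A.proj (q⁻¹ * p) x := by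
  induction x using homogeneous_induction with
  | zero => simp
  | add x y hx hy => simp only [mul_add, map_add, hx, hy]
  | mem h x hx =>
    by_cases hp : q * h = p
    · subst hp
      rw [proj_of_mem A (A.mul_mem ha hx), inv_mul_cancel_left, proj_of_mem A hx]
    · rw [proj_of_mem_ne A (A.mul_mem ha hx) hp, proj_of_mem_ne A hx, mul_zero]
      rintro rfl
      exact hp (mul_inv_cancel_left q p)

theorem proj_mul_right (A : GrAlg.{u, w} G) {q : G} {a : A.carrier} (ha : a ∈ A.deg q) (p : G)
    (x : A.carrier) : A.proj p (x * a) = A.proj (q⁻¹ * p) x * a := by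
  induction x using homogeneous_induction with
  | zero => simp
  | add x y hx hy => simp only [add_mul, map_add, hx, hy]
  | mem h x hx =>
    by_cases hp : h * q = p
    · subst hp
      rw [proj_of_mem A (A.mul_mem hx ha), mul_comm h, inv_mul_cancel_left, proj_of_mem A hx]
    · rw [proj_of_mem_ne A (A.mul_mem hx ha) hp, proj_of_mem_ne A hx, zero_mul]
      rintro rfl
      exact hp (by rw [mul_comm, mul_inv_cancel_left])

theorem exists_homogeneous_ne_zero {A : GrAlg.{u, w} G} {x : A.carrier} (hx : x ≠ 0) :
    ∃ g, A.proj g x ≠ 0 := by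
  by_contra! h
  exact hx (eq_zero_of_proj h)

theorem exists_homogeneous_mul_ne_zero {A : GrAlg.{u, w} G} (h : ∃ x y : A.carrier, x * y ≠ 0) :
    ∃ p q, ∃ x ∈ A.deg p, ∃ y ∈ A.deg q, x * y ≠ 0 := by
  obtain ⟨x, y, hxy⟩ := h
  by_contra! hc
  exact hxy (bilin_ext (LinearMap.mul ℝ A.carrier) 0 (fun p q x hx y hy => hc p q x hx y hy) x y)

/-! ### Graded ideals -/

/-- The workable form of gradedness of an ideal: stability under the homogeneous projections. -/
theorem eq_iSup_inf_deg_iff {A : GrAlg.{u, w} G} {I : Submodule ℝ A.carrier} :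
    I = ⨆ g, I ⊓ A.deg g ↔ ∀ g, ∀ x ∈ I, A.proj g x ∈ I := by
  constructor
  · intro h g x hx
    rw [h] at hx
    induction hx using Submodule.iSup_induction' with
    | zero => simp
    | add x y _ _ hx hy => rw [map_add]; exact add_mem hx hy
    | mem k x hx =>
      by_cases hk : k = g
      · subst hk; rw [proj_of_mem A hx.2]; exact hx.1
      · rw [proj_of_mem_ne A hx.2 hk]; exact zero_mem _
  · intro h
    refine le_antisymm (fun x hx => mem_of_proj fun g => ?_) (iSup_le fun g => inf_le_left)
    exact Submodule.mem_iSup_of_mem g ⟨h g x hx, A.proj_mem g x⟩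

theorem mul_mem_of_homogeneous {A : GrAlg.{u, w} G} {I : Submodule ℝ A.carrier}
    (h : ∀ q, ∀ a ∈ A.deg q, ∀ x ∈ I, a * x ∈ I ∧ x * a ∈ I) (a x : A.carrier) (hx : x ∈ I) :
    a * x ∈ I ∧ x * a ∈ I := by
  induction a using homogeneous_induction with
  | zero => simp
  | add a b ha hb =>
    rw [add_mul, mul_add]
    exact ⟨add_mem ha.1 hb.1, add_mem ha.2 hb.2⟩
  | mem q a ha => exact h q a ha x hx

/-- The largest subspace whose homogeneous components of degree `g` lie in `J g`. -/
noncomputable def ofComponents (A : GrAlg.{u, w} G) (J : G → Submodule ℝ A.carrier) :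
    Submodule ℝ A.carrier :=
  ⨅ g, (J g).comap (A.proj g)

theorem mem_ofComponents {A : GrAlg.{u, w} G} {J : G → Submodule ℝ A.carrier} {x : A.carrier} :
    x ∈ A.ofComponents J ↔ ∀ g, A.proj g x ∈ J g := by
  simp [ofComponents]

theorem mem_ofComponents_of_mem {A : GrAlg.{u, w} G} {J : G → Submodule ℝ A.carrier} {g : G}
    {x : A.carrier} (hx : x ∈ A.deg g) : x ∈ A.ofComponents J ↔ x ∈ J g := by
  rw [mem_ofComponents]
  constructor
  · intro h
    simpa only [A.proj_of_mem hx] using h g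
  · intro h k
    by_cases hk : g = k
    · subst hk; rwa [A.proj_of_mem hx]
    · rw [A.proj_of_mem_ne hx hk]; exact zero_mem _

theorem proj_mem_ofComponents {A : GrAlg.{u, w} G} {J : G → Submodule ℝ A.carrier} {g : G}
    {x : A.carrier} (hx : x ∈ A.ofComponents J) : A.proj g x ∈ A.ofComponents J :=
  (mem_ofComponents_of_mem (A.proj_mem g x)).2 (mem_ofComponents.1 hx g)

theorem mul_mem_ofComponents {A : GrAlg.{u, w} G} {J : G → Submodule ℝ A.carrier}
    (h : ∀ p q, ∀ a ∈ A.deg p, ∀ x ∈ A.deg q, x ∈ J q → a * x ∈ J (p * q) ∧ x * a ∈ J (p * q))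
    (a x : A.carrier) (hx : x ∈ A.ofComponents J) :
    a * x ∈ A.ofComponents J ∧ x * a ∈ A.ofComponents J := by
  refine mul_mem_of_homogeneous (fun q a ha x hx => ?_) a x hx
  rw [mem_ofComponents] at hx
  simp only [mem_ofComponents, proj_mul_left A ha, proj_mul_right A ha, ← forall_and]
  intro g
  have := h q (q⁻¹ * g) a ha _ (A.proj_mem _ x) (hx (q⁻¹ * g))
  rwa [mul_inv_cancel_left] at this

/-- Graded simplicity applied to `ofComponents J`. Ideals can thus be prescribed degree by degree,
with the ideal property tested on homogeneous elements only. -/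
theorem IsGradedSimple.eq_bot_or_top {A : GrAlg.{u, w} G} (hA : A.IsGradedSimple)
    {J : G → Submodule ℝ A.carrier}
    (h : ∀ p q, ∀ a ∈ A.deg p, ∀ x ∈ A.deg q, x ∈ J q → a * x ∈ J (p * q) ∧ x * a ∈ J (p * q)) :
    (∀ g, ∀ x ∈ A.deg g, x ∈ J g → x = 0) ∨ (∀ g, ∀ x ∈ A.deg g, x ∈ J g) := by
  refine (hA.2 (A.ofComponents J) (mul_mem_ofComponents h)
    (eq_iSup_inf_deg_iff.2 fun g x hx => proj_mem_ofComponents hx)).imp ?_ ?_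
  · intro hJ g x hx hxJ
    rwa [← mem_ofComponents_of_mem hx, hJ, Submodule.mem_bot] at hxJ
  · intro hJ g x hx
    rw [← mem_ofComponents_of_mem hx, hJ]
    exact Submodule.mem_top

/-! ### The centroid of a graded algebra -/

theorem mem_centroid_of_homogeneous {A : GrAlg.{u, w} G} {f : Module.End ℝ A.carrier}
    (h : ∀ p q, ∀ x ∈ A.deg p, ∀ y ∈ A.deg q, f (x * y) = x * f y ∧ f (x * y) = f x * y) :
    f ∈ centroid A.carrier := fun x y =>
  ⟨bilin_ext ((LinearMap.mul ℝ A.carrier).compr₂ f) ((LinearMap.mul ℝ A.carrier).compl₂ f)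
    (fun p q x hx y hy => (h p q x hx y hy).1) x y,
  bilin_ext ((LinearMap.mul ℝ A.carrier).compr₂ f) (LinearMap.mul ℝ A.carrier ∘ₗ f)
    (fun p q x hx y hy => (h p q x hx y hy).2) x y⟩

/-- The component of degree `p` of an element of the centroid. -/
noncomputable def centroidComp (A : GrAlg.{u, w} G) (c : centroid A.carrier) (p : G) :
    Module.End ℝ A.carrier :=
  A.lift fun q => A.proj (p * q) ∘ₗ (c : Module.End ℝ A.carrier)

theorem centroidComp_of_mem (A : GrAlg.{u, w} G) (c : centroid A.carrier) (p : G) {q : G}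
    {x : A.carrier} (hx : x ∈ A.deg q) :
    A.centroidComp c p x = A.proj (p * q) ((c : Module.End ℝ A.carrier) x) :=
  lift_of_mem A _ hx

theorem centroidComp_mem_deg (A : GrAlg.{u, w} G) (c : centroid A.carrier) (p : G) {q : G}
    {x : A.carrier} (hx : x ∈ A.deg q) : A.centroidComp c p x ∈ A.deg (p * q) := by
  rw [centroidComp_of_mem A c p hx]
  exact A.proj_mem _ _

/-- Multiplication by a homogeneous element shifts the projections, and commutativity of the group
matches the shifts on both sides. Nothing is said about c being a finite sum of its components, so
later arguments are made on one vector at a time. -/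
theorem centroidComp_mem (A : GrAlg.{u, w} G) (c : centroid A.carrier) (p : G) :
    A.centroidComp c p ∈ centroid A.carrier := by
  refine mem_centroid_of_homogeneous fun q r x hx y hy => ?_
  rw [centroidComp_of_mem A c p (A.mul_mem hx hy), centroidComp_of_mem A c p hx,
    centroidComp_of_mem A c p hy]
  constructor
  · rw [(c.2 x y).1, proj_mul_left A hx, mul_left_comm p, inv_mul_cancel_left]
  · rw [(c.2 x y).2, proj_mul_right A hy, mul_comm q r, mul_left_comm p, inv_mul_cancel_left]

/-! ### Graded-simple central algebras are simple -/

/-- Minimal support argument. In a nonzero ideal I, elements whose support has minimal shape are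
determined by a single component, and every homogeneous x is that component of exactly one of them.
Sending x to this element of I commutes with all multiplications, so it is a scalar by centrality,
and comparing components shows that it fixes x. -/
theorem IsGradedSimple.isCentralSimple {A : GrAlg.{u, w} G} (hA : A.IsGradedSimple)
    (hc : centroid A.carrier = ⊥) : A.IsCentralSimple := by
  classical
  refine ⟨hA.1, fun I hI => or_iff_not_imp_left.2 fun hI0 => ?_, hc⟩
  obtain ⟨x₀, hx₀, hx₀0⟩ := (Submodule.ne_bot_iff I).1 hI0
  -- `Y S k` consists of the elements of `I` supported in `k S`
  let Y : Finset G → G → Submodule ℝ A.carrier := fun S k =>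
    I ⊓ ⨅ l ∈ {l : G | k⁻¹ * l ∉ S}, LinearMap.ker (A.proj l)
  have memY : ∀ S k y, y ∈ Y S k ↔ y ∈ I ∧ ∀ l, k⁻¹ * l ∉ S → A.proj l y = 0 := by
    intro S k y
    simp [Y]
  -- S is a support up to translation, normalized to contain 1. Its cardinality is what gets
  -- minimized; the support of any nonzero element of I, translated by one of its points, shows that
  -- such an S exists.
  have hex : ∃ n, ∃ S : Finset G, S.card = n ∧ 1 ∈ S ∧ ∃ k, ∃ y ∈ Y S k, A.proj k y ≠ 0 := by
    obtain ⟨k, hk⟩ := exists_homogeneous_ne_zero hx₀0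
    obtain ⟨T, hT, -⟩ := A.exists_sum_proj x₀
    refine ⟨_, T.image (fun l => k⁻¹ * l), rfl, ?_, k, x₀, (memY _ _ _).2 ⟨hx₀, ?_⟩, hk⟩
    · refine Finset.mem_image.2 ⟨k, ?_, inv_mul_cancel k⟩
      by_contra h
      exact hk (hT k h)
    · intro l hl
      exact hT l fun h => hl (Finset.mem_image_of_mem _ h)
  obtain ⟨S, hSn, hS1, k₀, y₀, hy₀, hy₀0⟩ := Nat.find_spec hex
  -- If the component at k vanishes, the support lies in k (S \ {1}). Recentring at another point l
  -- of the support gives a smaller set containing 1, against minimality.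
  have hmin : ∀ k, ∀ y ∈ Y S k, A.proj k y = 0 → y = 0 := by
    intro k y hy hyk
    by_contra hy0
    obtain ⟨l, hl⟩ := exists_homogeneous_ne_zero hy0
    have hlk : l ≠ k := fun e => hl (e ▸ hyk)
    rw [memY] at hy
    have hlS : k⁻¹ * l ∈ S := by
      by_contra h
      exact hl (hy.2 l h)
    refine Nat.find_min hex (m := (S.erase 1).card) ?_
      ⟨(S.erase 1).image (fun t => l⁻¹ * k * t), ?_, ?_, l, y, (memY _ _ _).2 ⟨hy.1, ?_⟩, hl⟩
    · rw [← hSn]; exact Finset.card_erase_lt_of_mem hS1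
    · exact Finset.card_image_of_injective _ (mul_right_injective _)
    · refine Finset.mem_image.2 ⟨k⁻¹ * l, Finset.mem_erase.2 ⟨?_, hlS⟩, by group⟩
      exact fun h => hlk (inv_mul_eq_one.1 h).symm
    · intro m hm
      by_cases hmk : m = k
      · rw [hmk, hyk]
      · refine hy.2 m fun h => hm (Finset.mem_image.2 ⟨k⁻¹ * m, Finset.mem_erase.2 ⟨?_, h⟩, ?_⟩)
        · exact fun h => hmk (inv_mul_eq_one.1 h).symm
        · group
  have hmul : ∀ p k, ∀ a ∈ A.deg p, ∀ y ∈ Y S k, a * y ∈ Y S (p * k) ∧ y * a ∈ Y S (p * k) := by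
    intro p k a ha y hy
    rw [memY] at hy
    have h0 : ∀ l, (p * k)⁻¹ * l ∉ S → A.proj (p⁻¹ * l) y = 0 := fun l hl =>
      hy.2 _ (by rwa [mul_inv_rev, mul_assoc] at hl)
    refine ⟨(memY _ _ _).2 ⟨(hI a y hy.1).1, fun l hl => ?_⟩,
      (memY _ _ _).2 ⟨(hI a y hy.1).2, fun l hl => ?_⟩⟩
    · rw [proj_mul_left A ha, h0 l hl, mul_zero]
    · rw [proj_mul_right A ha, h0 l hl, zero_mul]
  -- The components at k of the elements of `Y S k` form a graded ideal by `hmul`; it is nonzero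
  -- because of y₀, hence everything.
  have hsurj : ∀ k, ∀ x ∈ A.deg k, ∃ y ∈ Y S k, A.proj k y = x := by
    refine (hA.eq_bot_or_top (J := fun k => (Y S k).map (A.proj k)) ?_).resolve_left ?_
    · rintro p k a ha _ - ⟨y, hy, rfl⟩
      refine ⟨⟨a * y, (hmul p k a ha y hy).1, ?_⟩, ⟨y * a, (hmul p k a ha y hy).2, ?_⟩⟩
      · rw [proj_mul_left A ha, inv_mul_cancel_left]
      · rw [proj_mul_right A ha, inv_mul_cancel_left]
    · intro h
      exact hy₀0 (h k₀ _ (A.proj_mem _ _) ⟨y₀, hy₀, rfl⟩)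
  let e : ∀ k, Y S k ≃ₗ[ℝ] A.deg k := fun k =>
    LinearEquiv.ofBijective (((A.proj k) ∘ₗ (Y S k).subtype).codRestrict (A.deg k)
        fun y => A.proj_mem k y)
      ⟨(injective_iff_map_eq_zero _).2 fun y hy =>
        Subtype.ext (hmin k y y.2 (congrArg Subtype.val hy)),
      fun x => by
        obtain ⟨y, hy, hyx⟩ := hsurj k x x.2
        exact ⟨⟨y, hy⟩, Subtype.ext hyx⟩⟩
  let T : Module.End ℝ A.carrier := A.lift fun k =>
    (Y S k).subtype ∘ₗ (e k).symm.toLinearMap ∘ₗ (A.proj k).codRestrict (A.deg k) (A.proj_mem k)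
  have hT : ∀ k, ∀ x ∈ A.deg k, T x ∈ Y S k ∧ A.proj k (T x) = x := by
    intro k x hx
    have hTx : T x = (e k).symm ⟨A.proj k x, A.proj_mem k x⟩ := A.lift_of_mem _ hx
    rw [hTx]
    refine ⟨Subtype.mem _, ?_⟩
    have h := congrArg Subtype.val ((e k).apply_symm_apply ⟨A.proj k x, A.proj_mem k x⟩)
    exact h.trans (A.proj_of_mem hx)
  have hTuniq : ∀ k, ∀ x ∈ A.deg k, ∀ y ∈ Y S k, A.proj k y = x → T x = y := by
    intro k x hx y hy hyx
    refine sub_eq_zero.1 (hmin k _ (sub_mem (hT k x hx).1 hy) ?_)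
    rw [map_sub, (hT k x hx).2, hyx, sub_self]
  -- By `hTuniq` it suffices that x * T y and T x * y lie in the right `Y S k` and have the right
  -- component there.
  have hTc : T ∈ centroid A.carrier := by
    refine mem_centroid_of_homogeneous fun p q x hx y hy => ⟨?_, ?_⟩
    · refine hTuniq _ _ (A.mul_mem hx hy) _ (hmul p q x hx _ (hT q y hy).1).1 ?_
      rw [proj_mul_left A hx, inv_mul_cancel_left, (hT q y hy).2]
    · refine hTuniq _ _ (A.mul_mem hx hy) _ ?_ ?_
      · rw [mul_comm]
        exact (hmul q p y hy _ (hT p x hx).1).2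
      · rw [proj_mul_right A hy, mul_comm p, inv_mul_cancel_left, (hT p x hx).2]
  rw [hc, Algebra.mem_bot] at hTc
  obtain ⟨r, hr⟩ := hTc
  rw [eq_top_iff]
  intro x _
  refine mem_of_proj fun k => ?_
  -- With T = r, the component of T x_k at k is both r x_k and x_k. So x_k = T x_k, which lies in I.
  have hTx : T (A.proj k x) = r • A.proj k x := by rw [← hr]; rfl
  obtain ⟨h1, h2⟩ := hT k _ (A.proj_mem k x)
  rw [hTx, map_smul, A.proj_of_mem (A.proj_mem k x)] at h2
  rw [hTx, h2] at h1
  exact h1.1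

/-- The two-sided annihilator is an ideal, and it is not everything because the product is nonzero.
-/
theorem IsCentralSimple.eq_zero_of_annihilates {A : GrAlg.{u, w} G} (hA : A.IsCentralSimple)
    {a : A.carrier} (h : ∀ q, ∀ b ∈ A.deg q, a * b = 0 ∧ b * a = 0) : a = 0 := by
  let I : Submodule ℝ A.carrier :=
    { carrier := {x | ∀ b, x * b = 0 ∧ b * x = 0}
      add_mem' := fun hx hy b => by simp [add_mul, mul_add, hx b, hy b]
      zero_mem' := fun b => by simp
      smul_mem' := fun r x hx b => by simp [smul_mul_assoc, mul_smul_comm, (hx b).1, (hx b).2] }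
  have ha : a ∈ I := by
    intro b
    induction b using homogeneous_induction with
    | zero => simp
    | add b c hb hc => simp [mul_add, add_mul, hb, hc]
    | mem q b hb => exact h q b hb
  have hI : ∀ a, ∀ x ∈ I, a * x ∈ I ∧ x * a ∈ I := by
    intro a x hx
    rw [(hx a).1, (hx a).2]
    exact ⟨zero_mem _, zero_mem _⟩
  rcases hA.2.1 I hI with h0 | h1
  · rwa [h0, Submodule.mem_bot] at ha
  · obtain ⟨x, y, hxy⟩ := hA.1
    have hx : x ∈ I := h1 ▸ Submodule.mem_top
    exact absurd (hx y).1 hxy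

end GrAlg

/-! ### Transport along graded isomorphisms -/

namespace GradedEquiv

variable {G : Type u} [CommGroup G] {A B : GrAlg.{u, w} G}

/-- The inverse of a graded isomorphism. -/
def symm (φ : GradedEquiv A.deg B.deg) : GradedEquiv B.deg A.deg := Groupoid.inv (X := A) (Y := B) φ

theorem symm_map_mul (φ : GradedEquiv A.deg B.deg) (x y : B.carrier) :
    φ.toLinearEquiv.symm (x * y) = φ.toLinearEquiv.symm x * φ.toLinearEquiv.symm y :=
  φ.symm.map_mul x y

/-- Conjugation of an element of the centroid by a graded isomorphism. -/
def centroidConj (φ : GradedEquiv A.deg B.deg) (c : centroid A.carrier) : centroid B.carrier :=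
  ⟨φ.toLinearEquiv.conj c, fun x y => by
    simp only [LinearEquiv.conj_apply_apply, symm_map_mul]
    constructor
    · rw [(c.2 _ _).1, φ.map_mul, LinearEquiv.apply_symm_apply]
    · rw [(c.2 _ _).2, φ.map_mul, LinearEquiv.apply_symm_apply]⟩

theorem centroidConj_apply (φ : GradedEquiv A.deg B.deg) (c : centroid A.carrier)
    (x : A.carrier) : (φ.centroidConj c : Module.End ℝ B.carrier) (φ.toLinearEquiv x) =
      φ.toLinearEquiv ((c : Module.End ℝ A.carrier) x) := by
  simp [centroidConj, LinearEquiv.conj_apply_apply]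

theorem centroidConj_mem (φ : GradedEquiv A.deg B.deg) {c : centroid A.carrier} {g : G}
    (hc : c ∈ A.centroidDeg g) : φ.centroidConj c ∈ B.centroidDeg g := by
  intro h x hx
  obtain ⟨y, rfl⟩ := φ.toLinearEquiv.surjective x
  rw [centroidConj_apply, φ.map_mem_iff]
  exact hc h y ((φ.map_mem_iff h y).1 hx)

theorem isGradedSimple (φ : GradedEquiv A.deg B.deg) (hA : A.IsGradedSimple) :
    B.IsGradedSimple := by
  obtain ⟨⟨x, y, hxy⟩, hA⟩ := hA
  refine ⟨⟨φ.toLinearEquiv x, φ.toLinearEquiv y, ?_⟩, fun I hI hgr => ?_⟩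
  · rw [← φ.map_mul]
    exact fun h => hxy (φ.toLinearEquiv.map_eq_zero_iff.1 h)
  · rw [GrAlg.eq_iSup_inf_deg_iff] at hgr
    have hproj : ∀ g x, φ.toLinearEquiv (A.proj g x) = B.proj g (φ.toLinearEquiv x) := by
      intro g
      refine LinearMap.congr_fun (GrAlg.hom_ext (S := φ.toLinearEquiv.toLinearMap ∘ₗ A.proj g)
        (T := B.proj g ∘ₗ φ.toLinearEquiv.toLinearMap) fun k x hx => ?_)
      have hx' := (φ.map_mem_iff k x).2 hx
      simp only [LinearMap.comp_apply, LinearEquiv.coe_coe]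
      by_cases hk : k = g
      · subst hk
        rw [A.proj_of_mem hx, B.proj_of_mem hx']
      · rw [A.proj_of_mem_ne hx hk, B.proj_of_mem_ne hx' hk, map_zero]
    refine (hA (I.comap φ.toLinearEquiv.toLinearMap) (fun a x hx => ?_)
      (GrAlg.eq_iSup_inf_deg_iff.2 fun g x hx => ?_)).imp (fun h => ?_) (fun h => ?_)
    · simp only [Submodule.mem_comap, LinearEquiv.coe_coe, φ.map_mul] at hx ⊢
      exact hI _ _ hx
    · simp only [Submodule.mem_comap, LinearEquiv.coe_coe, hproj] at hx ⊢
      exact hgr g _ hx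
    · rw [eq_bot_iff]
      intro x hx
      obtain ⟨y, rfl⟩ := φ.toLinearEquiv.surjective x
      have : y ∈ I.comap φ.toLinearEquiv.toLinearMap := hx
      rw [h, Submodule.mem_bot] at this
      simp [this]
    · rw [eq_top_iff]
      intro x _
      obtain ⟨y, rfl⟩ := φ.toLinearEquiv.surjective x
      have : y ∈ I.comap φ.toLinearEquiv.toLinearMap := h ▸ Submodule.mem_top
      exact this

/-- A graded isomorphism from a pair of inverse linear maps respecting degrees. -/
def ofInverse (f : A.carrier →ₗ[ℝ] B.carrier) (f' : B.carrier →ₗ[ℝ] A.carrier)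
    (hf : ∀ g, ∀ x ∈ A.deg g, f x ∈ B.deg g ∧ f' (f x) = x)
    (hf' : ∀ g, ∀ x ∈ B.deg g, f' x ∈ A.deg g ∧ f (f' x) = x)
    (hmul : ∀ g h, ∀ x ∈ A.deg g, ∀ y ∈ A.deg h, f (x * y) = f x * f y) :
    GradedEquiv A.deg B.deg where
  toLinearEquiv := LinearEquiv.ofLinearMap f f'
    (GrAlg.hom_ext fun g x hx => (hf' g x hx).2) (GrAlg.hom_ext fun g x hx => (hf g x hx).2)
  map_mul := GrAlg.bilin_ext ((LinearMap.mul ℝ A.carrier).compr₂ f)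
    ((LinearMap.mul ℝ B.carrier).compl₁₂ f f) hmul
  map_mem_iff g x := by
    refine ⟨fun h => ?_, fun h => (hf g x h).1⟩
    have h1 := (hf' g _ h).1
    have h2 : f' ∘ₗ f = LinearMap.id := GrAlg.hom_ext fun g x hx => (hf g x hx).2
    have h3 : f' (f x) = x := LinearMap.congr_fun h2 x
    exact h3 ▸ h1

end GradedEquiv

section LoopCoordinates

variable {G : Type u} {Gbar : Type v} [CommGroup G] [CommGroup Gbar] (π : G →* Gbar)
  (χ : G →* Circle)

/-! ### Homogeneous bases of the real loop algebra of the field -/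

/-- A square root z of c works: it has modulus 1, so conj z * z² = |z|² z = z. -/
theorem exists_loopRoot (c : Circle) : ∃ z : ℂ, z ≠ 0 ∧ starRingEnd ℂ z * c = z := by
  obtain ⟨z, hz⟩ := IsAlgClosed.exists_pow_nat_eq (c : ℂ) (n := 2) two_pos
  have hn : ‖z‖ = 1 := by
    have : ‖z‖ ^ 2 = 1 := by rw [← norm_pow, hz, Circle.norm_coe]
    exact (pow_eq_one_iff_of_nonneg (norm_nonneg z) two_ne_zero).1 this
  refine ⟨z, fun h => by simp [h] at hn, ?_⟩
  rw [← hz, pow_two, ← mul_assoc, Complex.conj_mul', hn]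
  simp

/-- A nonzero complex number with `z / conj z = χ g`. -/
noncomputable def loopRoot (g : G) : ℂ := (exists_loopRoot (χ g)).choose

theorem loopRoot_ne_zero (g : G) : loopRoot χ g ≠ 0 := (exists_loopRoot (χ g)).choose_spec.1

theorem conj_loopRoot_mul (g : G) : starRingEnd ℂ (loopRoot χ g) * χ g = loopRoot χ g :=
  (exists_loopRoot (χ g)).choose_spec.2

/-- The real 2-cocycle of the basis `loopRoot χ g ⊗ g`. -/
noncomputable def loopCocycle (g h : G) : ℝ :=
  (loopRoot χ g * loopRoot χ h / loopRoot χ (g * h)).re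

/-- The quotient of the roots is fixed by conjugation because χ(gh) = χ(g) χ(h), so taking the real
part in `loopCocycle` loses nothing. -/
theorem loopRoot_mul (g h : G) :
    loopRoot χ g * loopRoot χ h = loopCocycle χ g h * loopRoot χ (g * h) := by
  have hr : starRingEnd ℂ (loopRoot χ g * loopRoot χ h / loopRoot χ (g * h)) =
      loopRoot χ g * loopRoot χ h / loopRoot χ (g * h) := by
    have h1 := conj_loopRoot_mul χ g
    have h2 := conj_loopRoot_mul χ h
    have h3 := conj_loopRoot_mul χ (g * h)
    have n3 := (map_ne_zero (starRingEnd ℂ)).2 (loopRoot_ne_zero χ (g * h))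
    rw [map_mul χ, Circle.coe_mul] at h3
    rw [map_div₀, map_mul]
    have n4 := loopRoot_ne_zero χ (g * h)
    rw [div_eq_div_iff n3 n4]
    conv_lhs => rw [← h3]
    conv_rhs => rw [← h1, ← h2]
    ring
  have hq := Complex.conj_eq_iff_re.1 hr
  rw [loopCocycle, hq, div_mul_cancel₀ _ (loopRoot_ne_zero χ _)]

theorem loopCocycle_ne_zero (g h : G) : loopCocycle χ g h ≠ 0 := by
  intro h0
  have := loopRoot_mul χ g h
  rw [h0, Complex.ofReal_zero, zero_mul] at this
  exact mul_ne_zero (loopRoot_ne_zero χ g) (loopRoot_ne_zero χ h) this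

theorem loopCocycle_comm (g h : G) : loopCocycle χ g h = loopCocycle χ h g := by
  simp only [loopCocycle, mul_comm]

/-- Associativity of the product of three roots, read off after cancelling the root of ghk. -/
theorem loopCocycle_assoc (g h k : G) :
    loopCocycle χ g h * loopCocycle χ (g * h) k = loopCocycle χ h k * loopCocycle χ g (h * k) := by
  apply Complex.ofReal_injective
  apply mul_right_cancel₀ (loopRoot_ne_zero χ (g * h * k))
  simp only [Complex.ofReal_mul]
  rw [mul_assoc, ← loopRoot_mul, mul_assoc g, mul_assoc (loopCocycle χ h k : ℂ), ← loopRoot_mul,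
    ← mul_assoc, ← loopRoot_mul, mul_left_comm, ← loopRoot_mul, mul_assoc]

/-- The root at 1 is merely some chosen number, so the cocycle need not be normalized; this constant
is the factor by which u_1 differs from an identity. -/
theorem loopCocycle_one_left (g : G) : loopCocycle χ 1 g = loopCocycle χ 1 1 := by
  have h := loopCocycle_assoc χ 1 1 g
  rw [one_mul, one_mul] at h
  exact (mul_right_cancel₀ (loopCocycle_ne_zero χ 1 g) h).symm

/-- The complex coefficient of `g`, divided by `loopRoot χ g`, followed by the real part. -/
noncomputable def rootCoeff (g : G) : MonoidAlgebra ℂ G →ₗ[ℝ] ℝ :=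
  Complex.reLm ∘ₗ LinearMap.mulLeft ℝ (loopRoot χ g)⁻¹ ∘ₗ Finsupp.lapply g ∘ₗ
    (MonoidAlgebra.coeffLinearEquiv (S := ℂ) (M := G) ℝ).toLinearMap

theorem rootCoeff_single_same (g : G) (z : ℂ) :
    rootCoeff χ g (MonoidAlgebra.single g z) = ((loopRoot χ g)⁻¹ * z).re := by
  simp [rootCoeff]

theorem rootCoeff_single_ne {g h : G} (hne : h ≠ g) (z : ℂ) :
    rootCoeff χ g (MonoidAlgebra.single h z) = 0 := by
  simp [rootCoeff, hne]

/-- The element `u_g` of degree `g`. -/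
noncomputable def loopUnit (g : G) : MonoidAlgebra ℂ G := MonoidAlgebra.single g (loopRoot χ g)

theorem rootCoeff_loopUnit (g : G) : rootCoeff χ g (loopUnit χ g) = 1 := by
  rw [loopUnit, rootCoeff_single_same, inv_mul_cancel₀ (loopRoot_ne_zero χ g), Complex.one_re]

theorem galois_loopUnit (g : G) : galois χ (loopUnit χ g) = loopUnit χ g := by
  rw [loopUnit, galois_single, conj_loopRoot_mul]

theorem loopUnit_mul (g h : G) :
    loopUnit χ g * loopUnit χ h = loopCocycle χ g h • loopUnit χ (g * h) := by
  rw [loopUnit, loopUnit, loopUnit, MonoidAlgebra.single_mul_single, loopRoot_mul,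
    MonoidAlgebra.smul_single, Complex.real_smul]

/-! ### Coordinates on real loop algebras -/

variable (A : GrAlg.{v, w} Gbar)

/-- The map `a ⊗ u ↦ rootCoeff χ g u • a` on `A ⊗ ℂG`. -/
noncomputable def ambCoord (g : G) : Ambient (G := G) A →ₗ[ℝ] A.carrier :=
  (TensorProduct.rid ℝ A.carrier).toLinearMap ∘ₗ
    TensorProduct.map LinearMap.id (rootCoeff χ g)

theorem ambCoord_tmul (g : G) (a : A.carrier) (t : MonoidAlgebra ℂ G) :
    ambCoord χ A g (a ⊗ₜ t) = rootCoeff χ g t • a := by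
  simp [ambCoord]

theorem ambCoord_mem {g : G} {x : Ambient (G := G) A} (hx : x ∈ complexLoopDeg π A g) :
    ambCoord χ A g x ∈ A.deg (π g) := by
  induction hx using Submodule.span_induction with
  | zero => simp
  | add a b _ _ ha hb => rw [map_add]; exact add_mem ha hb
  | smul r a _ ha => rw [map_smul]; exact Submodule.smul_mem _ r ha
  | mem a ha =>
    obtain ⟨a, ha, z, rfl⟩ := ha
    rw [ambCoord_tmul]
    exact Submodule.smul_mem _ _ ha

theorem ambCoord_ne {g h : G} (hne : h ≠ g) {x : Ambient (G := G) A}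
    (hx : x ∈ complexLoopDeg π A h) : ambCoord χ A g x = 0 := by
  induction hx using Submodule.span_induction with
  | zero => simp
  | add a b _ _ ha hb => rw [map_add, ha, hb, add_zero]
  | smul r a _ ha => rw [map_smul, ha, smul_zero]
  | mem a ha =>
    obtain ⟨a, ha, z, rfl⟩ := ha
    rw [ambCoord_tmul, rootCoeff_single_ne χ hne, zero_smul]

/-- Averaging over the Galois action: for z = z_g t the element z plus its image is z_g (t + conj t)
= 2 Re(t) z_g. On a fixed point the sum is 2x, and the factor 2 cancels. -/
theorem tmul_ambCoord {g : G} {x : Ambient (G := G) A} (hx : x ∈ complexLoopDeg π A g)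
    (hfix : ambGalois χ A x = x) : ambCoord χ A g x ⊗ₜ loopUnit χ g = x := by
  have key : ∀ x ∈ complexLoopDeg π A g, (2 : ℝ) • (ambCoord χ A g x ⊗ₜ[ℝ] loopUnit χ g) =
      x + ambGalois χ A x := by
    intro x hx
    induction hx using Submodule.span_induction with
    | zero => simp
    | add a b _ _ ha hb =>
      rw [map_add, map_add, TensorProduct.add_tmul, smul_add, ha, hb]; abel
    | smul r a _ ha =>
      rw [map_smul, map_smul, ← TensorProduct.smul_tmul', smul_comm, ha, smul_add]
    | mem a ha =>
      obtain ⟨a, ha, z, rfl⟩ := ha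
      rw [ambCoord_tmul, rootCoeff_single_same, ambGalois, TensorProduct.map_tmul,
        LinearMap.id_apply, AlgHom.toLinearMap_apply, galois_single, ← TensorProduct.tmul_add,
        ← MonoidAlgebra.single_add, TensorProduct.smul_tmul, ← TensorProduct.tmul_smul, loopUnit,
        MonoidAlgebra.smul_single, MonoidAlgebra.smul_single]
      congr 2
      obtain ⟨t, rfl⟩ : ∃ t, z = loopRoot χ g * t :=
        ⟨(loopRoot χ g)⁻¹ * z, (mul_inv_cancel_left₀ (loopRoot_ne_zero χ g) z).symm⟩
      rw [inv_mul_cancel_left₀ (loopRoot_ne_zero χ g), map_mul, mul_right_comm,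
        conj_loopRoot_mul, ← mul_add, Complex.add_conj, Complex.real_smul, Complex.real_smul]
      push_cast
      ring
  have h2 := key x hx
  rw [hfix, ← two_smul ℝ x] at h2
  exact smul_right_injective _ (two_ne_zero (α := ℝ)) h2

theorem tmul_loopUnit_mem {g : G} {a : A.carrier} (ha : a ∈ A.deg (π g)) :
    a ⊗ₜ[ℝ] loopUnit χ g ∈ complexLoopDeg π A g :=
  Submodule.subset_span ⟨a, ha, _, rfl⟩

theorem tmul_loopUnit_mem_loop {g : G} {a : A.carrier} (ha : a ∈ A.deg (π g)) :
    a ⊗ₜ[ℝ] loopUnit χ g ∈ loopSubalgebra π χ A :=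
  ⟨Submodule.mem_iSup_of_mem g (tmul_loopUnit_mem π χ A ha), by
    rw [ambGalois, TensorProduct.map_tmul, LinearMap.id_apply, AlgHom.toLinearMap_apply,
      galois_loopUnit]⟩

/-- The map `a ↦ a ⊗ u_g`, precomposed with the projection onto the component of degree
`π g`. -/
noncomputable def loopι (g : G) : A.carrier →ₗ[ℝ] (loop π χ A).carrier :=
  ((TensorProduct.mk ℝ A.carrier (MonoidAlgebra ℂ G)).flip (loopUnit χ g) ∘ₗ
      A.proj (π g)).codRestrict (NonUnitalSubalgebra.toSubmodule (loopSubalgebra π χ A))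
    fun a => tmul_loopUnit_mem_loop π χ A (A.proj_mem _ a)

/-- The inclusion of the real loop algebra into `A ⊗ ℂG`. -/
noncomputable def loopVal : (loop π χ A).carrier →ₗ[ℝ] Ambient (G := G) A :=
  (NonUnitalSubalgebra.toSubmodule (loopSubalgebra π χ A)).subtype

theorem loopVal_injective : Function.Injective (loopVal π χ A) := Subtype.val_injective

theorem loopVal_mul (x y : (loop π χ A).carrier) :
    loopVal π χ A (x * y) = loopVal π χ A x * loopVal π χ A y := rfl

/-- The map `a ⊗ u_g ↦ a`, vanishing on the components of degree other than `g`. -/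
noncomputable def loopCoord (g : G) : (loop π χ A).carrier →ₗ[ℝ] A.carrier :=
  ambCoord χ A g ∘ₗ loopVal π χ A

variable {A}

theorem loopVal_loopι {g : G} {a : A.carrier} (ha : a ∈ A.deg (π g)) :
    loopVal π χ A (loopι π χ A g a) = a ⊗ₜ loopUnit χ g := by
  change A.proj (π g) a ⊗ₜ[ℝ] loopUnit χ g = _
  rw [A.proj_of_mem ha]

theorem loopι_mem (g : G) (a : A.carrier) : loopι π χ A g a ∈ (loop π χ A).deg g :=
  tmul_loopUnit_mem π χ A (A.proj_mem _ a)

theorem loopCoord_mem (g : G) (x : (loop π χ A).carrier) : loopCoord π χ A g x ∈ A.deg (π g) := by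
  induction x using GrAlg.homogeneous_induction with
  | zero => simp
  | add x y hx hy => rw [map_add]; exact add_mem hx hy
  | mem h x hx =>
    by_cases hg : h = g
    · subst hg; exact ambCoord_mem π χ A hx
    · rw [show loopCoord π χ A g x = 0 from ambCoord_ne π χ A hg hx]
      exact zero_mem _

theorem loopCoord_of_mem_ne {g h : G} {x : (loop π χ A).carrier} (hx : x ∈ (loop π χ A).deg h)
    (hne : h ≠ g) : loopCoord π χ A g x = 0 :=
  ambCoord_ne π χ A hne hx

theorem loopCoord_loopι {g : G} {a : A.carrier} (ha : a ∈ A.deg (π g)) :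
    loopCoord π χ A g (loopι π χ A g a) = a := by
  change ambCoord χ A g (A.proj (π g) a ⊗ₜ[ℝ] loopUnit χ g) = a
  rw [A.proj_of_mem ha, ambCoord_tmul, rootCoeff_loopUnit, one_smul]

theorem loopι_loopCoord {g : G} {x : (loop π χ A).carrier} (hx : x ∈ (loop π χ A).deg g) :
    loopι π χ A g (loopCoord π χ A g x) = x :=
  loopVal_injective π χ A <| (loopVal_loopι π χ (loopCoord_mem π χ g x)).trans (tmul_ambCoord π χ A hx x.2.2)

theorem exists_eq_loopι {g : G} {x : (loop π χ A).carrier} (hx : x ∈ (loop π χ A).deg g) :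
    ∃ a ∈ A.deg (π g), loopι π χ A g a = x :=
  ⟨_, loopCoord_mem π χ g x, loopι_loopCoord π χ hx⟩

theorem loopι_injOn {g : G} {a b : A.carrier} (ha : a ∈ A.deg (π g)) (hb : b ∈ A.deg (π g))
    (h : loopι π χ A g a = loopι π χ A g b) : a = b := by
  rw [← loopCoord_loopι π χ ha, h, loopCoord_loopι π χ hb]

theorem loopι_ne_zero {g : G} {a : A.carrier} (ha : a ∈ A.deg (π g)) (h0 : a ≠ 0) :
    loopι π χ A g a ≠ 0 := fun h =>
  h0 (loopι_injOn π χ ha (zero_mem _) (by rw [h, map_zero]))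

theorem loopι_mul {g h : G} {a b : A.carrier} (ha : a ∈ A.deg (π g)) (hb : b ∈ A.deg (π h)) :
    loopι π χ A g a * loopι π χ A h b = loopCocycle χ g h • loopι π χ A (g * h) (a * b) := by
  have hab : a * b ∈ A.deg (π (g * h)) := map_mul π g h ▸ A.mul_mem ha hb
  apply loopVal_injective
  rw [loopVal_mul, map_smul, loopVal_loopι π χ ha, loopVal_loopι π χ hb, loopVal_loopι π χ hab,
    Algebra.TensorProduct.tmul_mul_tmul, loopUnit_mul, TensorProduct.tmul_smul]

theorem loop_proj (g : G) (x : (loop π χ A).carrier) :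
    (loop π χ A).proj g x = loopι π χ A g (loopCoord π χ A g x) := by
  induction x using GrAlg.homogeneous_induction with
  | zero => simp
  | add x y hx hy => simp only [map_add, hx, hy]
  | mem h x hx =>
    by_cases hg : h = g
    · subst hg; rw [GrAlg.proj_of_mem _ hx, loopι_loopCoord π χ hx]
    · rw [GrAlg.proj_of_mem_ne _ hx hg, loopCoord_of_mem_ne π χ hx hg, map_zero]

theorem loop_hom_ext {M : Type*} [AddCommGroup M] [Module ℝ M]
    {S T : (loop π χ A).carrier →ₗ[ℝ] M}
    (h : ∀ g, ∀ a ∈ A.deg (π g), S (loopι π χ A g a) = T (loopι π χ A g a)) : S = T :=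
  GrAlg.hom_ext fun g x hx => by
    obtain ⟨a, ha, rfl⟩ := exists_eq_loopι π χ hx
    exact h g a ha

end LoopCoordinates

section LoopCentroid

variable {G : Type u} {Gbar : Type v} [CommGroup G] [CommGroup Gbar] (π : G →* Gbar)
  (χ : G →* Circle)

/-- The two sides are the constants of u_k (u_g u_l) and u_g (u_k u_l). Symmetry of the cocycle
enters here; it makes u_g commute with left multiplications as well as right ones. -/
theorem loopCocycle_left_comm (g k l : G) : loopCocycle χ g l * loopCocycle χ k (g * l) =
    loopCocycle χ k l * loopCocycle χ g (k * l) := by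
  rw [← loopCocycle_assoc, ← loopCocycle_assoc, loopCocycle_comm χ k g, mul_comm k g]

theorem GrAlg.IsCentralSimple.exists_ne_zero {A : GrAlg.{v, w} Gbar} (hA : A.IsCentralSimple) :
    ∃ p, ∃ a ∈ A.deg p, a ≠ 0 := by
  obtain ⟨p, -, a, ha, b, -, hab⟩ := GrAlg.exists_homogeneous_mul_ne_zero hA.1
  exact ⟨p, a, ha, left_ne_zero_of_mul hab⟩

/-! ### Lifting the centroid to the loop algebra -/

variable (A : GrAlg.{v, w} Gbar)

/-- The operator `a ⊗ u_k ↦ f a ⊗ u_g u_k` of the loop algebra. -/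
noncomputable def loopLift (g : G) (f : Module.End ℝ A.carrier) :
    Module.End ℝ (loop π χ A).carrier :=
  (loop π χ A).lift fun k =>
    loopCocycle χ g k • (loopι π χ A (g * k) ∘ₗ f ∘ₗ loopCoord π χ A k)

variable {A}

theorem loopLift_loopι (g : G) (f : Module.End ℝ A.carrier) {k : G} {a : A.carrier}
    (ha : a ∈ A.deg (π k)) : loopLift π χ A g f (loopι π χ A k a) =
      loopCocycle χ g k • loopι π χ A (g * k) (f a) := by
  rw [loopLift, GrAlg.lift_of_mem _ _ (loopι_mem π χ k a), LinearMap.smul_apply,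
    LinearMap.comp_apply, LinearMap.comp_apply, loopCoord_loopι π χ ha]

/-- The element of the centroid of the loop algebra attached to a homogeneous element of degree
`π g` of the centroid. -/
noncomputable def centroidLift (g : G) (f : centroid A.carrier) (hf : f ∈ A.centroidDeg (π g)) :
    centroid (loop π χ A).carrier :=
  ⟨loopLift π χ A g f, by
    refine GrAlg.mem_centroid_of_homogeneous fun k l x hx y hy => ?_
    obtain ⟨a, ha, rfl⟩ := exists_eq_loopι π χ hx
    obtain ⟨b, hb, rfl⟩ := exists_eq_loopι π χ hy
    have hab : a * b ∈ A.deg (π (k * l)) := map_mul π k l ▸ A.mul_mem ha hb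
    have hfa : (f : Module.End ℝ A.carrier) a ∈ A.deg (π (g * k)) := map_mul π g k ▸ hf _ a ha
    have hfb : (f : Module.End ℝ A.carrier) b ∈ A.deg (π (g * l)) := map_mul π g l ▸ hf _ b hb
    rw [loopι_mul π χ ha hb, map_smul, loopLift_loopι π χ g _ hab, loopLift_loopι π χ g _ ha,
      loopLift_loopι π χ g _ hb, mul_smul_comm, smul_mul_assoc, loopι_mul π χ ha hfb,
      loopι_mul π χ hfa hb, smul_smul, smul_smul, smul_smul]
    constructor
    · rw [(f.2 a b).1, ← loopCocycle_left_comm, mul_left_comm g k l]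
    · rw [(f.2 a b).2, ← loopCocycle_assoc, mul_assoc g k l]⟩

theorem centroidLift_loopι (g : G) (f : centroid A.carrier) (hf : f ∈ A.centroidDeg (π g))
    {k : G} {a : A.carrier} (ha : a ∈ A.deg (π k)) :
    (centroidLift π χ g f hf : Module.End ℝ _) (loopι π χ A k a) =
      loopCocycle χ g k • loopι π χ A (g * k) ((f : Module.End ℝ A.carrier) a) :=
  loopLift_loopι π χ g _ ha

theorem centroidLift_mem (g : G) (f : centroid A.carrier) (hf : f ∈ A.centroidDeg (π g)) :
    centroidLift π χ g f hf ∈ (loop π χ A).centroidDeg g := by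
  intro k x hx
  obtain ⟨a, ha, rfl⟩ := exists_eq_loopι π χ hx
  rw [centroidLift_loopι π χ g f hf ha]
  exact Submodule.smul_mem _ _ (loopι_mem π χ _ _)

theorem loop_centroid_ext {c d : centroid (loop π χ A).carrier}
    (h : ∀ k, ∀ a ∈ A.deg (π k), (c : Module.End ℝ _) (loopι π χ A k a) =
      (d : Module.End ℝ _) (loopι π χ A k a)) : c = d :=
  Subtype.ext (loop_hom_ext π χ h)

/-- The centroid identities give F_k(a) b = F_{kl}(ab) = a F_l(b). The right side does not involve
k, so F_k is determined by the degree π(k), and the F_k glue to an operator on A. -/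
theorem exists_centroidLift (hπ : Function.Surjective π) (hA : A.IsCentralSimple) {g : G}
    {c : centroid (loop π χ A).carrier} (hc : c ∈ (loop π χ A).centroidDeg g) :
    ∃ (f : centroid A.carrier) (hf : f ∈ A.centroidDeg (π g)), c = centroidLift π χ g f hf := by
  let F : G → Module.End ℝ A.carrier := fun k => (loopCocycle χ g k)⁻¹ •
    (loopCoord π χ A (g * k) ∘ₗ (c : Module.End ℝ _) ∘ₗ loopι π χ A k)
  have hFmem : ∀ k a, F k a ∈ A.deg (π (g * k)) := fun k a =>
    Submodule.smul_mem _ _ (loopCoord_mem π χ _ _)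
  have hF : ∀ k a, (c : Module.End ℝ _) (loopι π χ A k a) =
      loopCocycle χ g k • loopι π χ A (g * k) (F k a) := by
    intro k a
    simp only [F, LinearMap.smul_apply, LinearMap.comp_apply, map_smul]
    rw [smul_inv_smul₀ (loopCocycle_ne_zero χ g k),
      loopι_loopCoord π χ (hc k _ (loopι_mem π χ k a))]
  have hmul : ∀ k l, ∀ a ∈ A.deg (π k), ∀ b ∈ A.deg (π l),
      F (k * l) (a * b) = F k a * b ∧ F (k * l) (a * b) = a * F l b := by
    intro k l a ha b hb
    have hFab := hFmem (k * l) (a * b)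
    have h := c.2 (loopι π χ A k a) (loopι π χ A l b)
    rw [hF, hF, loopι_mul π χ ha hb, map_smul, hF, mul_smul_comm, smul_mul_assoc,
      loopι_mul π χ ha (hFmem l b), loopι_mul π χ (hFmem k a) hb, smul_smul, smul_smul,
      smul_smul, ← loopCocycle_left_comm, ← mul_left_comm g k l] at h
    obtain ⟨h1, h2⟩ := h
    rw [loopCocycle_left_comm, ← loopCocycle_assoc, mul_assoc g k l] at h2
    have hne := fun k l => loopCocycle_ne_zero χ k l
    constructor
    · refine loopι_injOn π χ hFab ?_
        (smul_right_injective _ (mul_ne_zero (hne g k) (hne (g * k) l)) h2)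
      rw [← mul_assoc, map_mul π (g * k)]
      exact A.mul_mem (hFmem k a) hb
    · refine loopι_injOn π χ hFab ?_
        (smul_right_injective _ (mul_ne_zero (hne g l) (hne k (g * l))) h1)
      rw [mul_left_comm, map_mul π k]
      exact A.mul_mem ha (hFmem l b)
  -- The difference F_k(a) - F_{k'}(a) annihilates every homogeneous b on both sides.
  have hind : ∀ k k', π k = π k' → ∀ a ∈ A.deg (π k), F k a = F k' a := by
    intro k k' hk a ha
    have ha' : a ∈ A.deg (π k') := hk ▸ ha
    refine sub_eq_zero.1 (hA.eq_zero_of_annihilates fun q b hb => ?_)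
    obtain ⟨l, rfl⟩ := hπ q
    obtain ⟨h1, h2⟩ := hmul k l a ha b hb
    obtain ⟨h3, h4⟩ := hmul k' l a ha' b hb
    obtain ⟨h5, h6⟩ := hmul l k b hb a ha
    obtain ⟨h7, h8⟩ := hmul l k' b hb a ha'
    rw [sub_mul, mul_sub, ← h1, h2, ← h3, h4, ← h6, h5, ← h8, h7]
    exact ⟨sub_self _, sub_self _⟩
  let f : Module.End ℝ A.carrier := A.lift fun p => F (Function.surjInv hπ p)
  have hf : ∀ k, ∀ a ∈ A.deg (π k), f a = F k a := by
    intro k a ha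
    have hs := Function.surjInv_eq hπ (π k)
    exact (A.lift_of_mem _ ha).trans (hind _ _ hs a (hs.symm ▸ ha))
  refine ⟨⟨f, GrAlg.mem_centroid_of_homogeneous fun p q a ha b hb => ?_⟩, fun p a ha => ?_,
    loop_centroid_ext π χ fun k a ha => ?_⟩
  · obtain ⟨k, rfl⟩ := hπ p
    obtain ⟨l, rfl⟩ := hπ q
    rw [hf (k * l) _ (map_mul π k l ▸ A.mul_mem ha hb), hf k a ha, hf l b hb]
    exact ⟨(hmul k l a ha b hb).2, (hmul k l a ha b hb).1⟩
  · obtain ⟨k, rfl⟩ := hπ p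
    change f a ∈ _
    rw [hf k a ha, ← map_mul]
    exact hFmem k a
  · refine Eq.trans ?_ (centroidLift_loopι π χ g _ _ ha).symm
    rw [hF, ← hf k a ha]

/-- The action of `u_g` on the loop algebra, for `g` in the kernel. -/
noncomputable def unitLift (A : GrAlg.{v, w} Gbar) (g : G) (hg : π g = 1) : centroid (loop π χ A).carrier :=
  centroidLift π χ g 1 fun p a ha => by rw [hg, one_mul]; exact ha

theorem unitLift_loopι {g : G} (hg : π g = 1) {k : G} {a : A.carrier} (ha : a ∈ A.deg (π k)) :
    (unitLift π χ A g hg : Module.End ℝ (loop π χ A).carrier) (loopι π χ A k a) =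
      loopCocycle χ g k • loopι π χ A (g * k) a :=
  centroidLift_loopι π χ g _ _ ha

theorem unitLift_mem {g : G} (hg : π g = 1) :
    (unitLift π χ A g hg : centroid (loop π χ A).carrier) ∈ (loop π χ A).centroidDeg g :=
  centroidLift_mem π χ g _ _

theorem unitLift_mul {g h : G} (hg : π g = 1) (hh : π h = 1) :
    (unitLift π χ A g hg * unitLift π χ A h hh : centroid (loop π χ A).carrier) =
      loopCocycle χ g h • unitLift π χ A (g * h) (by rw [map_mul, hg, hh, one_mul]) := by
  refine loop_centroid_ext π χ fun k a ha => ?_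
  change (unitLift π χ A g hg : Module.End ℝ (loop π χ A).carrier)
    ((unitLift π χ A h hh : Module.End ℝ (loop π χ A).carrier) _) =
    loopCocycle χ g h • (unitLift π χ A (g * h) _ : Module.End ℝ (loop π χ A).carrier) _
  have ha' : a ∈ A.deg (π (h * k)) := by rwa [map_mul, hh, one_mul]
  rw [unitLift_loopι π χ hh ha, unitLift_loopι π χ _ ha, map_smul, unitLift_loopι π χ hg ha',
    smul_smul, smul_smul, loopCocycle_assoc, mul_assoc g h k]

theorem exists_eq_smul_of_central {c : centroid A.carrier} (hc : centroid A.carrier = ⊥) :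
    ∃ r : ℝ, ∀ a, (c : Module.End ℝ A.carrier) a = r • a := by
  obtain ⟨r, hr⟩ := Algebra.mem_bot.1 (hc.le c.2)
  exact ⟨r, fun a => by rw [← hr]; rfl⟩

theorem exists_smul_unitLift (hπ : Function.Surjective π) (hA : A.IsCentralSimple) {g : G}
    (hg : π g = 1) {c : centroid (loop π χ A).carrier} (hc : c ∈ (loop π χ A).centroidDeg g) :
    ∃ r : ℝ, c = r • unitLift π χ A g hg := by
  obtain ⟨f, hf, rfl⟩ := exists_centroidLift π χ hπ hA hc
  obtain ⟨r, hr⟩ := exists_eq_smul_of_central (c := f) hA.2.2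
  refine ⟨r, loop_centroid_ext π χ fun k a ha => ?_⟩
  change _ = r • (unitLift π χ A g hg : Module.End ℝ (loop π χ A).carrier) _
  rw [centroidLift_loopι π χ g f hf ha, unitLift_loopι π χ hg ha, hr, map_smul, smul_comm]

theorem eq_zero_of_mem_centroidDeg (hπ : Function.Surjective π) (hA : A.IsCentralSimple) {g : G}
    (hg : π g ≠ 1) {c : centroid (loop π χ A).carrier} (hc : c ∈ (loop π χ A).centroidDeg g) :
    c = 0 := by
  obtain ⟨f, hf, rfl⟩ := exists_centroidLift π χ hπ hA hc
  obtain ⟨r, hr⟩ := exists_eq_smul_of_central (c := f) hA.2.2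
  refine loop_centroid_ext π χ fun k a ha => ?_
  have h0 : (f : Module.End ℝ A.carrier) a = 0 := by
    by_contra hne
    -- The operator f shifts degrees by π(g) yet is a scalar, so f a is homogeneous of two different
    -- degrees unless it vanishes.
    refine hg (mul_eq_right.1 (GrAlg.eq_of_mem_of_mem (hf _ a ha) ?_ hne))
    rw [hr]
    exact Submodule.smul_mem _ _ ha
  rw [centroidLift_loopι π χ g f hf ha, h0, map_zero, smul_zero]
  rfl

/-! ### Graded simplicity of the loop algebra -/

theorem isGradedSimple_loop (hπ : Function.Surjective π) (hA : A.IsCentralSimple) :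
    (loop π χ A).IsGradedSimple := by
  constructor
  · obtain ⟨p, q, a, ha, b, hb, hab⟩ := GrAlg.exists_homogeneous_mul_ne_zero hA.1
    obtain ⟨g, rfl⟩ := hπ p
    obtain ⟨h, rfl⟩ := hπ q
    refine ⟨loopι π χ A g a, loopι π χ A h b, ?_⟩
    rw [loopι_mul π χ ha hb]
    exact smul_ne_zero (loopCocycle_ne_zero χ g h)
      (loopι_ne_zero π χ (map_mul π g h ▸ A.mul_mem ha hb) hab)
  · intro I hI hgr
    rw [GrAlg.eq_iSup_inf_deg_iff] at hgr
    -- A single lift of a in I is enough: multiplying it by b ⊗ u_l, with l running over all lifts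
    -- of q, places the products in I at every lift k of their degree.
    have hmul : ∀ g k q, ∀ a ∈ A.deg (π g), ∀ b ∈ A.deg q, loopι π χ A g a ∈ I → q * π g = π k →
        loopι π χ A k (b * a) ∈ I ∧ loopι π χ A k (a * b) ∈ I := by
      intro g k q a ha b hb haI hk
      obtain ⟨l, rfl⟩ : ∃ l, k = l * g := ⟨k * g⁻¹, by group⟩
      rw [map_mul, mul_left_inj] at hk
      subst hk
      have h := hI (loopι π χ A l b) _ haI
      rw [loopι_mul π χ ha hb, loopι_mul π χ hb ha, mul_comm g l,
        I.smul_mem_iff (loopCocycle_ne_zero χ _ _),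
        I.smul_mem_iff (loopCocycle_ne_zero χ _ _)] at h
      exact h
    have hA' : A.IsGradedSimple := ⟨hA.1, fun I hI _ => hA.2.1 I hI⟩
    -- All lifts of p are required, so that J depends on p alone. An element with just one lift in I
    -- need not be in J, but by `hmul` its products are; if J = 0 it annihilates A and so is zero.
    let J : Gbar → Submodule ℝ A.carrier := fun p =>
      ⨅ g ∈ {g : G | π g = p}, I.comap (loopι π χ A g)
    have memJ : ∀ p a, a ∈ J p ↔ ∀ g, π g = p → loopι π χ A g a ∈ I := by
      intro p a
      simp [J]
    refine (hA'.eq_bot_or_top (J := J) fun p q a ha b hb hbJ => ?_).imp (fun h => ?_)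
      (fun h => ?_)
    · obtain ⟨g, rfl⟩ := hπ q
      rw [memJ] at hbJ
      simp only [memJ, ← forall_and]
      exact fun k hk => hmul g k p b hb a ha (hbJ g rfl) hk.symm
    · rw [eq_bot_iff]
      intro x hx
      refine GrAlg.eq_zero_of_proj fun g => ?_
      have hxg := hgr g x hx
      rw [loop_proj] at hxg ⊢
      have ha := loopCoord_mem π χ (A := A) g x
      suffices hs : loopCoord π χ A g x = 0 by rw [hs, map_zero]
      refine hA.eq_zero_of_annihilates fun q b hb => ⟨?_, ?_⟩
      · refine h _ _ (A.mul_mem ha hb) ((memJ _ _).2 fun k hk => ?_)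
        exact (hmul g k q _ ha b hb hxg (by rw [hk, mul_comm])).2
      · refine h _ _ (A.mul_mem hb ha) ((memJ _ _).2 fun k hk => ?_)
        exact (hmul g k q _ ha b hb hxg hk.symm).1
    · rw [eq_top_iff]
      intro x _
      refine GrAlg.mem_of_proj fun g => ?_
      rw [loop_proj]
      exact (memJ _ _).1 (h (π g) _ (loopCoord_mem π χ g x)) g rfl

/-! ### The centroid of the loop algebra -/

theorem mem_trivialReal_deg_of_eq_one {p : Gbar} (hp : p = 1)
    (r : (GrAlg.trivialReal Gbar).carrier) : r ∈ (GrAlg.trivialReal Gbar).deg p := by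
  have h : (⊤ : Submodule ℝ ℝ) ≤ ⨆ _ : p = 1, ⊤ := le_iSup_of_le hp le_rfl
  exact h Submodule.mem_top

theorem eq_zero_of_mem_trivialReal_deg {p : Gbar} (hp : p ≠ 1)
    {r : (GrAlg.trivialReal Gbar).carrier} (hr : r ∈ (GrAlg.trivialReal Gbar).deg p) : r = 0 := by
  change r ∈ (⨆ _ : p = 1, (⊤ : Submodule ℝ ℝ)) at hr
  rwa [iSup_neg hp] at hr

/-- The element `r u_g` of the real loop algebra of the field, for `g` in the kernel. -/
noncomputable def realι (g : G) : ℝ →ₗ[ℝ] (loop π χ (GrAlg.trivialReal Gbar)).carrier :=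
  loopι π χ (GrAlg.trivialReal Gbar) g

/-- The coefficient of `u_g` of an element of the real loop algebra of the field. -/
noncomputable def realCoeff (g : G) : (loop π χ (GrAlg.trivialReal Gbar)).carrier →ₗ[ℝ] ℝ :=
  loopCoord π χ (GrAlg.trivialReal Gbar) g

theorem realι_mem (g : G) (r : ℝ) :
    realι π χ g r ∈ (loop π χ (GrAlg.trivialReal Gbar)).deg g :=
  loopι_mem π χ g _

theorem realCoeff_realι {g : G} (hg : π g = 1) (r : ℝ) :
    realCoeff π χ g (realι π χ g r) = r :=
  loopCoord_loopι π χ (mem_trivialReal_deg_of_eq_one hg r)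

theorem realCoeff_realι_ne {g h : G} (hne : h ≠ g) (r : ℝ) :
    realCoeff π χ g (realι π χ h r) = 0 :=
  loopCoord_of_mem_ne π χ (realι_mem π χ h r) hne

theorem realι_mul {g h : G} (hg : π g = 1) (hh : π h = 1) (r t : ℝ) :
    realι π χ g r * realι π χ h t = loopCocycle χ g h • realι π χ (g * h) (r * t) :=
  loopι_mul π χ (mem_trivialReal_deg_of_eq_one hg r) (mem_trivialReal_deg_of_eq_one hh t)

theorem real_ext {x y : (loop π χ (GrAlg.trivialReal Gbar)).carrier}
    (h : ∀ g, realCoeff π χ g x = realCoeff π χ g y) : x = y := by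
  refine sub_eq_zero.1 (GrAlg.eq_zero_of_proj fun g => ?_)
  have hg : realCoeff π χ g (x - y) = 0 := by rw [map_sub, h, sub_self]
  rw [loop_proj]
  exact (congrArg (realι π χ g) hg).trans (map_zero _)

/-- Every homogeneous element of the loop algebra of the field is zero, or a multiple of `u_g` for
an element `g` of the kernel. -/
theorem loop_trivialReal_cases {g : G} {x : (loop π χ (GrAlg.trivialReal Gbar)).carrier}
    (hx : x ∈ (loop π χ (GrAlg.trivialReal Gbar)).deg g) :
    x = 0 ∨ π g = 1 ∧ ∃ r, x = realι π χ g r := by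
  obtain ⟨r, hr, rfl⟩ := exists_eq_loopι π χ hx
  by_cases hg : π g = 1
  · exact Or.inr ⟨hg, r, rfl⟩
  · rw [eq_zero_of_mem_trivialReal_deg hg hr]
    exact Or.inl (map_zero _)

open scoped Classical in
/-- The action of `u_g` on the loop algebra if `g` lies in the kernel, and `0` otherwise. -/
noncomputable def unitLiftOrZero (A : GrAlg.{v, w} Gbar) (g : G) : centroid (loop π χ A).carrier :=
  if hg : π g = 1 then unitLift π χ A g hg else 0

/-- The action of the real loop algebra of the field on the loop algebra. -/
noncomputable def loopAction (A : GrAlg.{v, w} Gbar) :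
    (loop π χ (GrAlg.trivialReal Gbar)).carrier →ₗ[ℝ] centroid (loop π χ A).carrier :=
  (loop π χ (GrAlg.trivialReal Gbar)).lift fun g =>
    LinearMap.toSpanSingleton ℝ (centroid (loop π χ A).carrier) (unitLiftOrZero π χ A g) ∘ₗ
      realCoeff π χ g

theorem loopAction_realι {g : G} (hg : π g = 1) (r : ℝ) :
    loopAction π χ A (realι π χ g r) = r • unitLift π χ A g hg := by
  rw [loopAction, GrAlg.lift_of_mem _ _ (realι_mem π χ g r), LinearMap.comp_apply,
    LinearMap.toSpanSingleton_apply, unitLiftOrZero, dif_pos hg, realCoeff_realι π χ hg]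

theorem loopAction_mul (x y : (loop π χ (GrAlg.trivialReal Gbar)).carrier) :
    loopAction π χ A (x * y) = loopAction π χ A x * loopAction π χ A y := by
  refine GrAlg.bilin_ext ((LinearMap.mul ℝ _).compr₂ (loopAction π χ A))
    ((LinearMap.mul ℝ (centroid (loop π χ A).carrier)).compl₁₂ (loopAction π χ A)
      (loopAction π χ A)) (fun g h x hx y hy => ?_) x y
  change loopAction π χ A (x * y) = loopAction π χ A x * loopAction π χ A y
  rcases loop_trivialReal_cases π χ hx with rfl | ⟨hg, r, rfl⟩
  · simp
  rcases loop_trivialReal_cases π χ hy with rfl | ⟨hh, t, rfl⟩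
  · simp
  have hgh : π (g * h) = 1 := by rw [map_mul, hg, hh, one_mul]
  rw [realι_mul π χ hg hh, map_smul, loopAction_realι π χ hg, loopAction_realι π χ hh,
    loopAction_realι π χ hgh, smul_mul_smul_comm, unitLift_mul, smul_comm]

theorem loopCoord_smul_unitLift {h k : G} (hh : π h = 1) {a : A.carrier} (ha : a ∈ A.deg (π k))
    (r : ℝ) : loopCoord π χ A (h * k)
      (((r • unitLift π χ A h hh : centroid _) : Module.End ℝ _) (loopι π χ A k a)) =
        (loopCocycle χ h k * r) • a := by
  change loopCoord π χ A (h * k) (r •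
    (unitLift π χ A h hh : Module.End ℝ (loop π χ A).carrier) (loopι π χ A k a)) = _
  rw [unitLift_loopι π χ hh ha, map_smul, map_smul,
    loopCoord_loopι π χ (by rwa [map_mul, hh, one_mul]), smul_smul, mul_comm]

/-- All coefficients of x can be read off from its action on a single nonzero a ⊗ u_k. This serves
for injectivity, surjectivity and the detection of degrees. -/
theorem loopCoord_loopAction {k : G} {a : A.carrier} (ha : a ∈ A.deg (π k)) (g : G)
    (x : (loop π χ (GrAlg.trivialReal Gbar)).carrier) :
    loopCoord π χ A (g * k) ((loopAction π χ A x : Module.End ℝ _) (loopι π χ A k a)) =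
      (loopCocycle χ g k * realCoeff π χ g x) • a := by
  induction x using GrAlg.homogeneous_induction with
  | zero => simp
  | add x y hx hy =>
    rw [map_add, map_add]
    refine (map_add (loopCoord π χ A (g * k)) _ _).trans ?_
    rw [hx, hy, ← add_smul, ← mul_add]
  | mem h x hx =>
    rcases loop_trivialReal_cases π χ hx with rfl | ⟨hh, r, rfl⟩
    · simp
    · by_cases hg : h = g
      · subst hg
        rw [loopAction_realι π χ hh, loopCoord_smul_unitLift π χ hh ha, realCoeff_realι π χ hh]
      · rw [realCoeff_realι_ne π χ hg, mul_zero, zero_smul, loopAction_realι π χ hh]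
        refine loopCoord_of_mem_ne π χ (Submodule.smul_mem _ r (unitLift_mem π χ hh) k _
          (loopι_mem π χ k a)) (fun e => hg (mul_right_cancel e))

theorem loop_ext {x y : (loop π χ A).carrier}
    (h : ∀ g, loopCoord π χ A g x = loopCoord π χ A g y) : x = y := by
  refine sub_eq_zero.1 (GrAlg.eq_zero_of_proj fun g => ?_)
  rw [loop_proj, map_sub, h, sub_self, map_zero]

theorem loopCoord_eq_zero_of_loopAction {k : G} {a : A.carrier} (ha : a ∈ A.deg (π k))
    (h0 : a ≠ 0) {g : G} {x : (loop π χ (GrAlg.trivialReal Gbar)).carrier}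
    (hx : loopCoord π χ A (g * k) ((loopAction π χ A x : Module.End ℝ _) (loopι π χ A k a)) = 0) :
    realCoeff π χ g x = 0 := by
  rw [loopCoord_loopAction π χ ha] at hx
  exact (mul_eq_zero.1 ((smul_eq_zero.1 hx).resolve_right h0)).resolve_left
    (loopCocycle_ne_zero χ g k)

/-- The homogeneous components of an element of the centroid of the loop algebra are real multiples
of the operators `u_g`. -/
theorem exists_centroid_coeff (hπ : Function.Surjective π) (hA : A.IsCentralSimple)
    (c : centroid (loop π χ A).carrier) (g : G) :
    ∃ r : ℝ, (π g ≠ 1 → r = 0) ∧ ∀ l, ∀ b ∈ A.deg (π l),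
      loopCoord π χ A (g * l) ((c : Module.End ℝ _) (loopι π χ A l b)) =
        (loopCocycle χ g l * r) • b := by
  -- Take for d the component of c of degree g; it alone contributes to the coordinate at gl of the
  -- image of a vector of degree l.
  obtain ⟨d, hd, hcd⟩ : ∃ d ∈ (loop π χ A).centroidDeg g, ∀ l b,
      loopCoord π χ A (g * l) ((c : Module.End ℝ _) (loopι π χ A l b)) =
        loopCoord π χ A (g * l) ((d : Module.End ℝ _) (loopι π χ A l b)) := by
    refine ⟨⟨(loop π χ A).centroidComp c g, GrAlg.centroidComp_mem _ c g⟩,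
      fun h x hx => GrAlg.centroidComp_mem_deg _ c g hx, fun l b => ?_⟩
    change _ = loopCoord π χ A (g * l) ((loop π χ A).centroidComp c g _)
    rw [GrAlg.centroidComp_of_mem _ c g (loopι_mem π χ l b), loop_proj,
      loopCoord_loopι π χ (loopCoord_mem π χ _ _)]
  by_cases hg : π g = 1
  · obtain ⟨r, rfl⟩ := exists_smul_unitLift π χ hπ hA hg hd
    exact ⟨r, fun h => absurd hg h, fun l b hb => by
      rw [hcd, loopCoord_smul_unitLift π χ hg hb]⟩
  · refine ⟨0, fun _ => rfl, fun l b _ => ?_⟩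
    rw [hcd, eq_zero_of_mem_centroidDeg π χ hπ hA hg hd, mul_zero, zero_smul]
    exact map_zero _

theorem loopAction_injective (hπ : Function.Surjective π) (hA : A.IsCentralSimple) :
    Function.Injective (loopAction π χ A) := by
  obtain ⟨p, a, ha, ha0⟩ := hA.exists_ne_zero
  obtain ⟨k, rfl⟩ := hπ p
  refine (injective_iff_map_eq_zero _).2 fun x hx => real_ext π χ fun g => ?_
  rw [map_zero]
  refine loopCoord_eq_zero_of_loopAction π χ ha ha0 ?_
  rw [hx]
  exact map_zero (loopCoord π χ A (g * k))

theorem loopAction_surjective (hπ : Function.Surjective π) (hA : A.IsCentralSimple) :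
    Function.Surjective (loopAction π χ A) := by
  classical
  obtain ⟨p, a, ha, ha0⟩ := hA.exists_ne_zero
  obtain ⟨k, rfl⟩ := hπ p
  intro c
  choose r hrker hr using exists_centroid_coeff π χ hπ hA c
  obtain ⟨S, hS, -⟩ := (loop π χ A).exists_sum_proj ((c : Module.End ℝ _) (loopι π χ A k a))
  -- The value of c at a ⊗ u_k has finite support S, and its coordinate at gk is c(g, k) r_g a. So
  -- only the g in S k⁻¹ can have r_g ≠ 0, and the candidate preimage is a finite sum.
  let T := S.image fun l => l * k⁻¹
  have hT : ∀ g ∉ T, r g = 0 := by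
    intro g hg
    have hgS : g * k ∉ S := fun h =>
      hg (Finset.mem_image.2 ⟨g * k, h, mul_inv_cancel_right g k⟩)
    have h1 := hr g k a ha
    have h2 := hS _ hgS
    rw [loop_proj] at h2
    rw [loopι_injOn π χ (loopCoord_mem π χ _ _) (zero_mem _) (h2.trans (map_zero _).symm)] at h1
    exact (mul_eq_zero.1 ((smul_eq_zero.1 h1.symm).resolve_right ha0)).resolve_left
      (loopCocycle_ne_zero χ g k)
  have hsum : ∀ g, realCoeff π χ g (∑ h ∈ T, realι π χ h (r h)) = r g := by
    have hself : ∀ g, realCoeff π χ g (realι π χ g (r g)) = r g := by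
      intro g
      by_cases hg : π g = 1
      · exact realCoeff_realι π χ hg _
      · rw [hrker g hg, map_zero, map_zero]
    intro g
    rw [map_sum, Finset.sum_eq_single g (fun h _ hne => realCoeff_realι_ne π χ hne _), hself]
    intro hg
    rw [hself, hT g hg]
  refine ⟨∑ h ∈ T, realι π χ h (r h), loop_centroid_ext π χ fun l b hb => loop_ext π χ fun j => ?_⟩
  obtain ⟨g, rfl⟩ : ∃ g, j = g * l := ⟨j * l⁻¹, by group⟩
  rw [loopCoord_loopAction π χ hb, hr g l b hb, hsum g]

theorem hasLoopCentroid_loop (hπ : Function.Surjective π) (hA : A.IsCentralSimple) :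
    HasLoopCentroid π χ (loop π χ A) := by
  refine ⟨isGradedSimple_loop π χ hπ hA,
    ⟨⟨LinearEquiv.ofBijective (loopAction π χ A) ⟨loopAction_injective π χ hπ hA, loopAction_surjective π χ hπ hA⟩,
      loopAction_mul π χ, fun g x => ⟨fun h => ?_, fun h => ?_⟩⟩⟩⟩
  · obtain ⟨p, a, ha, ha0⟩ := hA.exists_ne_zero
    obtain ⟨k, rfl⟩ := hπ p
    -- If x acts with degree g, the image of a ⊗ u_k has no coordinate at jk for j ≠ g, so the
    -- coefficient of x at j is zero.
    refine GrAlg.mem_deg_of_proj fun j hj => ?_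
    rw [loop_proj]
    suffices hs : loopCoord π χ (GrAlg.trivialReal Gbar) j x = 0 by rw [hs, map_zero]
    refine loopCoord_eq_zero_of_loopAction π χ ha ha0 ?_
    exact loopCoord_of_mem_ne π χ (h k _ (loopι_mem π χ k a))
      fun e => hj (mul_right_cancel e).symm
  · change loopAction π χ A x ∈ _
    rcases loop_trivialReal_cases π χ h with rfl | ⟨hg, r, rfl⟩
    · rw [map_zero]; exact zero_mem _
    · rw [loopAction_realι π χ hg]
      exact Submodule.smul_mem _ _ (unitLift_mem π χ hg)

/-! ### Descending from the loop algebra -/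

theorem isGradedSimple_of_loop (hπ : Function.Surjective π)
    (hL : (loop π χ A).IsGradedSimple) : A.IsGradedSimple := by
  constructor
  · obtain ⟨g, h, x, hx, y, hy, hxy⟩ := GrAlg.exists_homogeneous_mul_ne_zero hL.1
    obtain ⟨a, ha, rfl⟩ := exists_eq_loopι π χ hx
    obtain ⟨b, hb, rfl⟩ := exists_eq_loopι π χ hy
    refine ⟨a, b, fun hab => hxy ?_⟩
    rw [loopι_mul π χ ha hb, hab, map_zero, smul_zero]
  · intro I hI hgr
    rw [GrAlg.eq_iSup_inf_deg_iff] at hgr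
    refine (hL.eq_bot_or_top (J := fun g => I.comap (loopCoord π χ A g))
      fun g h x hx y hy hyI => ?_).imp (fun h => ?_) (fun h => ?_)
    · obtain ⟨a, ha, rfl⟩ := exists_eq_loopι π χ hx
      obtain ⟨b, hb, rfl⟩ := exists_eq_loopι π χ hy
      rw [Submodule.mem_comap, loopCoord_loopι π χ hb] at hyI
      have hab : a * b ∈ A.deg (π (g * h)) := map_mul π g h ▸ A.mul_mem ha hb
      have hba : b * a ∈ A.deg (π (h * g)) := map_mul π h g ▸ A.mul_mem hb ha
      rw [Submodule.mem_comap, Submodule.mem_comap, loopι_mul π χ ha hb, loopι_mul π χ hb ha,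
        map_smul, map_smul, loopCoord_loopι π χ hab, mul_comm g h, loopCoord_loopι π χ hba]
      exact ⟨I.smul_mem _ (hI a b hyI).1, I.smul_mem _ (hI a b hyI).2⟩
    · rw [eq_bot_iff]
      intro a haI
      refine GrAlg.eq_zero_of_proj fun p => ?_
      obtain ⟨g, rfl⟩ := hπ p
      by_contra hne
      refine loopι_ne_zero π χ (A.proj_mem (π g) a) hne (h g _ (loopι_mem π χ g _) ?_)
      rw [Submodule.mem_comap, loopCoord_loopι π χ (A.proj_mem _ a)]
      exact hgr _ a haI
    · rw [eq_top_iff]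
      intro a _
      refine GrAlg.mem_of_proj fun p => ?_
      obtain ⟨g, rfl⟩ := hπ p
      have := h g _ (loopι_mem π χ g (A.proj (π g) a))
      rwa [Submodule.mem_comap, loopCoord_loopι π χ (A.proj_mem _ a)] at this

/-- Each component of a centroid element of A lifts to the loop algebra. The hypotheses kill the
lifts of degree outside the kernel and make the lift of the component at 1 a scalar; they are stated
by degrees so that they can be transported from an isomorphic algebra. -/
theorem isCentralSimple_of_loop (hπ : Function.Surjective π) (hL : (loop π χ A).IsGradedSimple)
    (hone : ∀ c ∈ (loop π χ A).centroidDeg 1, ∃ r : ℝ, c = r • 1)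
    (hne : ∀ g, π g ≠ 1 → ∀ c ∈ (loop π χ A).centroidDeg g, c = 0) : A.IsCentralSimple := by
  refine (isGradedSimple_of_loop π χ hπ hL).isCentralSimple (eq_bot_iff.2 fun c hc => ?_)
  let C : Gbar → centroid A.carrier := fun p =>
    ⟨A.centroidComp ⟨c, hc⟩ p, GrAlg.centroidComp_mem _ _ p⟩
  have hC : ∀ p, C p ∈ A.centroidDeg p := fun p h x hx =>
    GrAlg.centroidComp_mem_deg _ ⟨c, hc⟩ p hx
  have hproj : ∀ p q, ∀ a ∈ A.deg q, A.proj (p * q) (c a) = (C p : Module.End ℝ A.carrier) a :=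
    fun p q a ha => (GrAlg.centroidComp_of_mem A ⟨c, hc⟩ p ha).symm
  have hzero : ∀ p, p ≠ 1 → ∀ q, ∀ a ∈ A.deg q, (C p : Module.End ℝ A.carrier) a = 0 := by
    intro p hp q a ha
    obtain ⟨g, rfl⟩ := hπ p
    obtain ⟨k, rfl⟩ := hπ q
    have h := centroidLift_loopι π χ g (C (π g)) (hC _) ha
    rw [hne g hp _ (centroidLift_mem π χ g (C (π g)) (hC _))] at h
    refine loopι_injOn π χ (map_mul π g k ▸ hC _ _ a ha) (zero_mem _) ?_
    rw [map_zero]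
    exact (smul_eq_zero.1 h.symm).resolve_left (loopCocycle_ne_zero χ g k)
  have hC1 : C 1 ∈ A.centroidDeg (π 1) := by rw [map_one]; exact hC 1
  obtain ⟨r, hr⟩ := hone _ (centroidLift_mem π χ 1 (C 1) hC1)
  -- The lift in degree 1 carries the factor c(1, k) = c(1, 1), whence the inverse.
  have hscalar : ∀ q, ∀ a ∈ A.deg q,
      (C 1 : Module.End ℝ A.carrier) a = ((loopCocycle χ 1 1)⁻¹ * r) • a := by
    intro q a ha
    obtain ⟨k, rfl⟩ := hπ q
    have h := centroidLift_loopι π χ 1 (C 1) hC1 ha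
    rw [hr] at h
    change r • loopι π χ A k a = _ at h
    rw [loopCocycle_one_left, one_mul, ← map_smul, ← map_smul] at h
    have hCa : (C 1 : Module.End ℝ A.carrier) a ∈ A.deg (π k) := by
      have := hC 1 _ a ha
      rwa [one_mul] at this
    have h' := loopι_injOn π χ (Submodule.smul_mem _ _ ha) (Submodule.smul_mem _ _ hCa) h
    rw [mul_smul, h', inv_smul_smul₀ (loopCocycle_ne_zero χ 1 1)]
  rw [Algebra.mem_bot]
  refine ⟨(loopCocycle χ 1 1)⁻¹ * r, GrAlg.hom_ext fun q a ha => ?_⟩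
  rw [Module.algebraMap_end_apply, ← hscalar q a ha, ← hproj 1 q a ha, one_mul]
  refine A.proj_of_mem (GrAlg.mem_deg_of_proj fun j hj => ?_)
  have := hproj (j * q⁻¹) q a ha
  rwa [inv_mul_cancel_right, hzero _ (fun e => hj (mul_inv_eq_one.1 e)) q a ha] at this

end LoopCentroid

section FullyFaithful

variable {G : Type u} {Gbar : Type v} [CommGroup G] [CommGroup Gbar] (π : G →* Gbar)
  (χ : G →* Circle) {ξ : Gbar → G} {hξ : Function.RightInverse ξ π}

/-! ### Kernel parts and the cocycle of the transversal. -/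

theorem coe_kerPart_mul (g : G) : (kerPart π ξ hξ g : G) * ξ (π g) = g :=
  inv_mul_cancel_right _ _

theorem kerPart_ker_mul (h : π.ker) (p : Gbar) : kerPart π ξ hξ (h * ξ p) = h := by
  apply Subtype.ext
  have hp : π (h * ξ p) = p := by rw [map_mul, h.2, hξ p, one_mul]
  simp only [kerPart, hp, mul_inv_cancel_right]

theorem coe_cocycle_mul (p q : Gbar) : (cocycle π ξ hξ p q : G) * ξ (p * q) = ξ p * ξ q :=
  inv_mul_cancel_right _ _

/-! ### The loop functor is faithful -/

theorem loopVal_loopMap {A A' : ExtObj.{u, v, w} π ξ hξ} (f : A ⟶ A')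
    (x : (loop π χ A.alg).carrier) : loopVal π χ A'.alg ((loopMap π χ f).toLinearEquiv x) =
      ambMap π f (loopVal π χ A.alg x) := rfl

theorem loopMap_loopι {A A' : ExtObj.{u, v, w} π ξ hξ} (f : A ⟶ A') {g : G} {a : A.alg.carrier}
    (ha : a ∈ A.alg.deg (π g)) : (loopMap π χ f).toLinearEquiv (loopι π χ A.alg g a) =
      (ExtHom.char f (kerPart π ξ hξ g) : ℝ) • loopι π χ A'.alg g (ExtHom.equiv f a) := by
  apply loopVal_injective
  rw [map_smul, loopVal_loopι π χ ((ExtHom.equiv_mem_iff f _ _).2 ha)]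
  rw [loopVal_loopMap, loopVal_loopι π χ ha, loopUnit, ambMap_tmul_single]

theorem loopMap_injective {A A' : ExtObj.{u, v, w} π ξ hξ} {f f' : A ⟶ A'}
    (h : loopMap π χ f = loopMap π χ f') : f = f' := by
  have key : ∀ g, ∀ a ∈ A.alg.deg (π g), (ExtHom.char f (kerPart π ξ hξ g) : ℝ) •
      ExtHom.equiv f a = (ExtHom.char f' (kerPart π ξ hξ g) : ℝ) • ExtHom.equiv f' a := by
    intro g a ha
    have h1 := (loopMap_loopι π χ f ha).symm
    rw [h, loopMap_loopι π χ f' ha, ← map_smul (loopι π χ A'.alg g),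
      ← map_smul (loopι π χ A'.alg g)] at h1
    have hf : ExtHom.equiv f a ∈ A'.alg.deg (π g) := (ExtHom.equiv_mem_iff f _ _).2 ha
    have hf' : ExtHom.equiv f' a ∈ A'.alg.deg (π g) := (ExtHom.equiv_mem_iff f' _ _).2 ha
    exact loopι_injOn π χ (Submodule.smul_mem _ _ hf) (Submodule.smul_mem _ _ hf') h1
  have hequiv : ∀ p, ∀ a ∈ A.alg.deg p, ExtHom.equiv f a = ExtHom.equiv f' a := by
    intro p a ha
    -- The kernel part of ξ(p) is 1, so in these degrees the character disappears and only ψ is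
    -- seen.
    have h1 := key (ξ p) a (by rwa [hξ p])
    have h2 := kerPart_ker_mul π (hξ := hξ) 1 p
    rw [OneMemClass.coe_one, one_mul] at h2
    simpa [h2] using h1
  refine ExtHom.ext' (MonoidHom.ext fun k => Units.ext ?_)
    (LinearMap.congr_fun (GrAlg.hom_ext (S := (ExtHom.equiv f).toLinearMap)
      (T := (ExtHom.equiv f').toLinearMap) hequiv))
  obtain ⟨p, a, ha, ha0⟩ := A.centralSimple.exists_ne_zero
  have hk : π (k * ξ p) = p := by rw [map_mul, k.2, hξ p, one_mul]
  -- The kernel part of k ξ(p) is k; one nonzero vector then determines the value of the character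
  -- at k.
  have h1 := key (k * ξ p) a (by rwa [hk])
  rw [kerPart_ker_mul, hequiv p a ha] at h1
  exact smul_left_injective ℝ (fun h0 => ha0 ((ExtHom.equiv f').map_eq_zero_iff.1 h0)) h1

/-! ### The loop functor is full -/

section Components

variable {A A' : GrAlg.{v, w} Gbar}
  (φ : GradedEquiv (loop π χ A).deg (loop π χ A').deg)

/-- The map `φ_k` with `φ (a ⊗ u_k) = φ_k a ⊗ u_k`. -/
noncomputable def equivComp (k : G) : A.carrier →ₗ[ℝ] A'.carrier :=
  loopCoord π χ A' k ∘ₗ φ.toLinearEquiv.toLinearMap ∘ₗ loopι π χ A k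

theorem equivComp_mem (k : G) (a : A.carrier) : equivComp π χ φ k a ∈ A'.deg (π k) :=
  loopCoord_mem π χ k _

theorem apply_loopι (k : G) (a : A.carrier) :
    φ.toLinearEquiv (loopι π χ A k a) = loopι π χ A' k (equivComp π χ φ k a) :=
  (loopι_loopCoord π χ ((φ.map_mem_iff k _).2 (loopι_mem π χ k a))).symm

theorem equivComp_symm_equivComp {k : G} {a : A.carrier} (ha : a ∈ A.deg (π k)) :
    equivComp π χ φ.symm k (equivComp π χ φ k a) = a := by
  change loopCoord π χ A k (φ.toLinearEquiv.symm (loopι π χ A' k (equivComp π χ φ k a))) = a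
  rw [← apply_loopι, LinearEquiv.symm_apply_apply, loopCoord_loopι π χ ha]

theorem equivComp_mul {k l : G} {a b : A.carrier} (ha : a ∈ A.deg (π k)) (hb : b ∈ A.deg (π l)) :
    equivComp π χ φ (k * l) (a * b) = equivComp π χ φ k a * equivComp π χ φ l b := by
  have h := φ.map_mul (loopι π χ A k a) (loopι π χ A l b)
  rw [loopι_mul π χ ha hb, map_smul, apply_loopι, apply_loopι, apply_loopι,
    loopι_mul π χ (equivComp_mem π χ φ k a) (equivComp_mem π χ φ l b)] at h
  refine loopι_injOn π χ (equivComp_mem π χ φ _ _) ?_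
    (smul_right_injective _ (loopCocycle_ne_zero χ k l) h)
  rw [map_mul]
  exact A'.mul_mem (equivComp_mem π χ φ k a) (equivComp_mem π χ φ l b)

/-- Conjugating the action of u_h by φ gives a centroid element of degree h, which by
`exists_smul_unitLift` is r times the action of u_h on the other side. The cocycle factors agree and
cancel. -/
theorem exists_equivComp_ker_mul (hπ : Function.Surjective π) (hA' : A'.IsCentralSimple)
    (h : π.ker) : ∃ r : ℝ, ∀ k, ∀ a ∈ A.deg (π k),
      equivComp π χ φ (h * k) a = r • equivComp π χ φ k a := by
  have hh : π h = 1 := h.2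
  obtain ⟨r, hr⟩ := exists_smul_unitLift π χ hπ hA' hh
    (φ.centroidConj_mem (unitLift_mem π χ (A := A) hh))
  refine ⟨r, fun k a ha => ?_⟩
  have h1 := φ.centroidConj_apply (unitLift π χ A h hh) (loopι π χ A k a)
  rw [hr] at h1
  change r • (unitLift π χ A' h hh : Module.End ℝ (loop π χ A').carrier) _ = _ at h1
  rw [unitLift_loopι π χ hh ha, map_smul, apply_loopι, apply_loopι,
    unitLift_loopι π χ hh (equivComp_mem π χ φ k a), smul_comm] at h1
  have h2 := smul_right_injective _ (loopCocycle_ne_zero χ (h : G) k) h1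
  simp only [← map_smul] at h2
  have hk : π (h * k) = π k := by rw [map_mul, hh, one_mul]
  refine (loopι_injOn π χ ?_ (equivComp_mem π χ φ _ _) h2).symm.trans (map_smul _ _ _)
  rw [hk]
  exact equivComp_mem π χ φ k _

theorem exists_char (hπ : Function.Surjective π) (hA : A.IsCentralSimple)
    (hA' : A'.IsCentralSimple) : ∃ lam : π.ker →* ℝˣ, ∀ (h : π.ker) (k : G),
      ∀ a ∈ A.deg (π k), equivComp π χ φ (h * k) a = (lam h : ℝ) • equivComp π χ φ k a := by
  choose r hr using exists_equivComp_ker_mul π χ φ hπ hA'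
  obtain ⟨p, a, ha, ha0⟩ := hA.exists_ne_zero
  obtain ⟨k, rfl⟩ := hπ p
  have hne : equivComp π χ φ k a ≠ 0 := fun h0 => ha0 (by
    rw [← equivComp_symm_equivComp π χ φ ha, h0, map_zero])
  have hinj := smul_left_injective ℝ hne
  let lam : π.ker →* ℝ :=
    { toFun := r
      map_one' := hinj (by
        have := hr 1 k a ha
        rw [OneMemClass.coe_one, one_mul] at this
        exact this.symm.trans (one_smul _ _).symm)
      map_mul' := fun h h' => hinj (by
        have hk : a ∈ A.deg (π (h' * k)) := by rwa [map_mul, h'.2, one_mul]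
        have h1 := hr (h * h') k a ha
        rw [Subgroup.coe_mul, mul_assoc, hr h _ a hk, hr h' k a ha, smul_smul] at h1
        exact h1.symm) }
  -- A monoid homomorphism defined on a group has values in the units.
  exact ⟨lam.toHomUnits, fun h k a ha => hr h k a ha⟩

end Components

/-- The preimage is (ψ, lam) with ψ = φ_{ξ(p)} in degree p. Since ξ(p) ξ(q) = σ(p, q) ξ(pq), one
gets ψ(x) ψ(y) = φ_{ξ(p)ξ(q)}(xy) = lam(σ(p, q)) ψ(xy). Writing g as its kernel part times ξ(π(g))
shows that the loop map agrees with φ. -/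
theorem exists_loopMap_eq {A A' : ExtObj.{u, v, w} π ξ hξ}
    (φ : GradedEquiv (loop π χ A.alg).deg (loop π χ A'.alg).deg) :
    ∃ f : A ⟶ A', loopMap π χ f = φ := by
  obtain ⟨lam, hlam⟩ := exists_char π χ φ hξ.surjective A.centralSimple A'.centralSimple
  have hdeg : ∀ {B : GrAlg.{v, w} Gbar} {p x}, x ∈ B.deg p → x ∈ B.deg (π (ξ p)) := by
    intro B p x hx
    rwa [hξ p]
  let ψ : A.alg.carrier →ₗ[ℝ] A'.alg.carrier := A.alg.lift fun p => equivComp π χ φ (ξ p)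
  let ψ' : A'.alg.carrier →ₗ[ℝ] A.alg.carrier := A'.alg.lift fun p => equivComp π χ φ.symm (ξ p)
  have hψ : ∀ p, ∀ a ∈ A.alg.deg p, ψ a = equivComp π χ φ (ξ p) a := fun p a ha =>
    A.alg.lift_of_mem _ ha
  have hψ' : ∀ p, ∀ a ∈ A'.alg.deg p, ψ' a = equivComp π χ φ.symm (ξ p) a := fun p a ha =>
    A'.alg.lift_of_mem _ ha
  have hmem : ∀ p, ∀ a ∈ A.alg.deg p, ψ a ∈ A'.alg.deg p := by
    intro p a ha
    rw [hψ p a ha]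
    have := equivComp_mem π χ φ (ξ p) a
    rwa [hξ p] at this
  have hmem' : ∀ p, ∀ a ∈ A'.alg.deg p, ψ' a ∈ A.alg.deg p := by
    intro p a ha
    rw [hψ' p a ha]
    have := equivComp_mem π χ φ.symm (ξ p) a
    rwa [hξ p] at this
  have hinv : ψ' ∘ₗ ψ = LinearMap.id := GrAlg.hom_ext fun p a ha => by
    rw [LinearMap.comp_apply, hψ' p _ (hmem p a ha), hψ p a ha,
      equivComp_symm_equivComp π χ φ (hdeg ha), LinearMap.id_apply]
  have hinv' : ψ ∘ₗ ψ' = LinearMap.id := GrAlg.hom_ext fun p a ha => by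
    rw [LinearMap.comp_apply, hψ p _ (hmem' p a ha), hψ' p a ha]
    exact equivComp_symm_equivComp π χ φ.symm (hdeg ha)
  let f : ExtHom π ξ hξ A A' := ExtHom.ofHomogeneous lam (LinearEquiv.ofLinearMap ψ ψ' hinv' hinv)
    (fun p q x hx y hy => by
      change (lam (cocycle π ξ hξ p q) : ℝ) • ψ (x * y) = ψ x * ψ y
      rw [hψ p x hx, hψ q y hy, ← equivComp_mul π χ φ (hdeg hx) (hdeg hy),
        hψ _ _ (A.alg.mul_mem hx hy), ← hlam _ _ _ (hdeg (A.alg.mul_mem hx hy)), coe_cocycle_mul])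
    (fun p x => ⟨fun h => by
      have hx : ψ' (ψ x) = x := LinearMap.congr_fun hinv x
      exact hx ▸ hmem' p (ψ x) h, hmem p x⟩)
  refine ⟨f, GradedEquiv.ext' (LinearMap.congr_fun (loop_hom_ext π χ
    (S := (loopMap π χ (A := A) (A' := A') f).toLinearEquiv.toLinearMap)
    (T := φ.toLinearEquiv.toLinearMap) fun g a ha => ?_))⟩
  refine (loopMap_loopι π χ (A := A) (A' := A') f ha).trans ?_
  change (lam (kerPart π ξ hξ g) : ℝ) • loopι π χ A'.alg g (ψ a) =
    φ.toLinearEquiv (loopι π χ A.alg g a)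
  rw [hψ _ a ha, apply_loopι, ← map_smul, ← hlam _ _ _ (hdeg ha), coe_kerPart_mul]

end FullyFaithful

/-! ### The components over a transversal. -/

section SectionSpan

variable {G : Type u} {ι : Type v} [CommGroup G] (ξ : ι → G) {B : GrAlg.{u, w} G}

/-- The subspace spanned by the components of degrees `ξ p`. -/
def sectionSpan (B : GrAlg.{u, w} G) : Submodule ℝ B.carrier := ⨆ p, B.deg (ξ p)

/-- The component of `sectionSpan` attached to `p`. -/
def sectionDeg (B : GrAlg.{u, w} G) (p : ι) : Submodule ℝ (sectionSpan ξ B) :=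
  (B.deg (ξ p)).comap (sectionSpan ξ B).subtype

theorem sectionDeg_indep (hinj : Function.Injective ξ) : iSupIndep (sectionDeg ξ B) := by
  intro p
  rw [Submodule.disjoint_def]
  intro x hx hx'
  refine Subtype.ext (Submodule.disjoint_def.1 (B.deg_indep (ξ p)) x hx ?_)
  have : (⨆ (q : ι) (_ : q ≠ p), sectionDeg ξ B q) ≤
      (⨆ (g : G) (_ : g ≠ ξ p), B.deg g).comap (sectionSpan ξ B).subtype :=
    iSup₂_le fun q hq y hy =>
      Submodule.mem_iSup_of_mem (ξ q) (Submodule.mem_iSup_of_mem (hinj.ne hq) hy)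
  exact this hx'

theorem sectionDeg_iSup : ⨆ p, sectionDeg ξ B p = ⊤ := by
  rw [eq_top_iff]
  rintro ⟨x, hx⟩ -
  have hx' := hx
  rw [sectionSpan] at hx'
  induction hx' using Submodule.iSup_induction' with
  | mem p x h => exact Submodule.mem_iSup_of_mem p h
  | zero => exact zero_mem _
  | add x y hx₁ hy₁ h1 h2 => exact add_mem (h1 hx₁) (h2 hy₁)

end SectionSpan

/-! ### The quotient of a graded algebra by an action of the kernel. -/

section Descent

variable {G : Type u} {Gbar : Type v} [CommGroup G] [CommGroup Gbar] (π : G →* Gbar)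

/-- An action of the kernel of `π` on a graded space with a graded product `μ`: the element `h` acts
by an operator of degree `h` in the centroid. -/
structure IsKernelAction (B : GrAlg.{u, w} G) (μ : B.carrier →ₗ[ℝ] B.carrier →ₗ[ℝ] B.carrier)
    (D : π.ker →* Module.End ℝ B.carrier) : Prop where
  mul_mem : ∀ {g h x y}, x ∈ B.deg g → y ∈ B.deg h → μ x y ∈ B.deg (g * h)
  map_mem : ∀ (h : π.ker) {g x}, x ∈ B.deg g → D h x ∈ B.deg (h * g)
  map_mul_left : ∀ (h : π.ker) {p q x y}, x ∈ B.deg p → y ∈ B.deg q → D h (μ x y) = μ (D h x) y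
  map_mul_right : ∀ (h : π.ker) {p q x y}, x ∈ B.deg p → y ∈ B.deg q → D h (μ x y) = μ x (D h y)

variable {π} (ξ : Gbar → G) (hξ : Function.RightInverse ξ π) {B : GrAlg.{u, w} G}
  {μ : B.carrier →ₗ[ℝ] B.carrier →ₗ[ℝ] B.carrier} {D : π.ker →* Module.End ℝ B.carrier}

/-- The projection of a component of degree `g` to the component of degree `ξ (π g)` given by the
action of the kernel. -/
noncomputable def sectionProj (D : π.ker →* Module.End ℝ B.carrier) :
    B.carrier →ₗ[ℝ] B.carrier :=
  B.lift fun g => D (kerPart π ξ hξ g)⁻¹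

theorem sectionProj_of_mem {g : G} {x : B.carrier} (hx : x ∈ B.deg g) :
    sectionProj ξ hξ D x = D (kerPart π ξ hξ g)⁻¹ x :=
  B.lift_of_mem _ hx

namespace IsKernelAction

theorem sectionProj_mem_deg (hD : IsKernelAction π B μ D) {g : G} {x : B.carrier} (hx : x ∈ B.deg g) :
    sectionProj ξ hξ D x ∈ B.deg (ξ (π g)) := by
  rw [sectionProj_of_mem ξ hξ hx]
  have h := hD.map_mem (kerPart π ξ hξ g)⁻¹ hx
  nth_rw 2 [← coe_kerPart_mul π (hξ := hξ) g] at h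
  rwa [Subgroup.coe_inv, inv_mul_cancel_left] at h

theorem sectionProj_mem (hD : IsKernelAction π B μ D) (x : B.carrier) : sectionProj ξ hξ D x ∈ sectionSpan ξ B := by
  induction x using GrAlg.homogeneous_induction with
  | zero => simp
  | add x y hx hy => rw [map_add]; exact add_mem hx hy
  | mem g x hx => exact Submodule.mem_iSup_of_mem (π g) (hD.sectionProj_mem_deg ξ hξ hx)

variable (hD : IsKernelAction π B μ D)

/-- `sectionProj` as a map to `sectionSpan`. -/
noncomputable def toSection : B.carrier →ₗ[ℝ] sectionSpan ξ B :=
  (sectionProj ξ hξ D).codRestrict (sectionSpan ξ B) (hD.sectionProj_mem ξ hξ)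

/-- The product of the quotient by the action of the kernel, realized on `sectionSpan`. -/
noncomputable def sectionMul : sectionSpan ξ B →ₗ[ℝ] sectionSpan ξ B →ₗ[ℝ] sectionSpan ξ B :=
  (μ.compl₁₂ (sectionSpan ξ B).subtype (sectionSpan ξ B).subtype).compr₂ (hD.toSection ξ hξ)

/-- The nonassociative ring with product `sectionMul`. -/
@[reducible] noncomputable def sectionRing : NonUnitalNonAssocRing (sectionSpan ξ B) :=
  { (inferInstance : AddCommGroup (sectionSpan ξ B)) with
    mul := fun x y => hD.sectionMul ξ hξ x y
    left_distrib := fun x y z => map_add (hD.sectionMul ξ hξ x) y z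
    right_distrib := fun x y z => LinearMap.map_add₂ (hD.sectionMul ξ hξ) x y z
    zero_mul := fun x => LinearMap.map_zero₂ (hD.sectionMul ξ hξ) x
    mul_zero := fun x => map_zero (hD.sectionMul ξ hξ x) }

/-- The quotient of a graded algebra by an action of the kernel of `π`. -/
noncomputable def quotient : GrAlg.{v, w} Gbar :=
  letI := hD.sectionRing ξ hξ
  { carrier := sectionSpan ξ B
    ring := hD.sectionRing ξ hξ
    module := (sectionSpan ξ B).module
    scalarTower := ⟨fun r x y => LinearMap.map_smul₂ (hD.sectionMul ξ hξ) r x y⟩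
    smulComm := ⟨fun r x y => (map_smul (hD.sectionMul ξ hξ x) r y).symm⟩
    deg := sectionDeg ξ B
    deg_indep := sectionDeg_indep ξ hξ.injective
    deg_iSup := sectionDeg_iSup ξ
    mul_mem := fun {p q x y} hx hy => by
      have h := hD.sectionProj_mem_deg ξ hξ (hD.mul_mem hx hy)
      rw [map_mul, hξ p, hξ q] at h
      exact h }

end IsKernelAction

end Descent

/-! ### Recovering an algebra as the loop algebra of a quotient. -/

section EssentiallySurjective

variable {G : Type u} {Gbar : Type v} [CommGroup G] [CommGroup Gbar] {π : G →* Gbar}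
  (χ : G →* Circle) {ξ : Gbar → G} {hξ : Function.RightInverse ξ π}

/-- The factor ξ(π(gk)) occurs in both terms on the left and cancels. This says that normalizing a
product to the transversal and moving it to degree gk amounts to moving the two factors to degrees g
and k. -/
theorem kerPart_mul_inv_mul (g k : G) :
    kerPart π ξ hξ (g * k) * (kerPart π ξ hξ (ξ (π g) * ξ (π k)))⁻¹ =
      kerPart π ξ hξ g * kerPart π ξ hξ k := by
  apply Subtype.ext
  simp only [kerPart, Subgroup.coe_mul, Subgroup.coe_inv, map_mul, hξ (π g), hξ (π k)]
  have : ∀ a b x y z : G, a * b * z⁻¹ * (x * y * z⁻¹)⁻¹ = a * x⁻¹ * (b * y⁻¹) := by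
    intro a b x y z
    rw [← div_eq_mul_inv (_ * z⁻¹), mul_div_mul_right_eq_div, mul_div_mul_comm, div_eq_mul_inv,
      div_eq_mul_inv]
  exact this _ _ _ _ _

theorem map_inv_apply_apply {H M : Type*} [Group H] [AddCommGroup M] [Module ℝ M]
    (D : H →* Module.End ℝ M) (h : H) (x : M) : D h⁻¹ (D h x) = x := by
  rw [← Module.End.mul_apply, ← map_mul, inv_mul_cancel, map_one, Module.End.one_apply]

theorem map_apply_inv_apply {H M : Type*} [Group H] [AddCommGroup M] [Module ℝ M]
    (D : H →* Module.End ℝ M) (h : H) (x : M) : D h (D h⁻¹ x) = x := by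
  rw [← Module.End.mul_apply, ← map_mul, mul_inv_cancel, map_one, Module.End.one_apply]

section Quotient

variable {B : GrAlg.{u, max u w} G}
  {μ : B.carrier →ₗ[ℝ] B.carrier →ₗ[ℝ] B.carrier} {D : π.ker →* Module.End ℝ B.carrier}
  (hD : IsKernelAction π B μ D)

variable (ξ hξ) in
/-- The inclusion of the quotient by an action of the kernel, as a subspace. -/
noncomputable def IsKernelAction.val : (hD.quotient ξ hξ).carrier →ₗ[ℝ] B.carrier :=
  (sectionSpan ξ B).subtype

variable (ξ hξ) in
/-- The quotient map of an action of the kernel. -/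
noncomputable def IsKernelAction.quotientMap : B.carrier →ₗ[ℝ] (hD.quotient ξ hξ).carrier :=
  hD.toSection ξ hξ

theorem IsKernelAction.val_injective : Function.Injective (hD.val ξ hξ) :=
  Subtype.val_injective

theorem IsKernelAction.val_mem {p : Gbar} {a : (hD.quotient ξ hξ).carrier} :
    hD.val ξ hξ a ∈ B.deg (ξ p) ↔ a ∈ (hD.quotient ξ hξ).deg p := Iff.rfl

theorem IsKernelAction.val_quotientMap (x : B.carrier) :
    hD.val ξ hξ (hD.quotientMap ξ hξ x) = sectionProj ξ hξ D x := rfl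

theorem IsKernelAction.val_mul (a b : (hD.quotient ξ hξ).carrier) :
    hD.val ξ hξ (a * b) = sectionProj ξ hξ D (μ (hD.val ξ hξ a) (hD.val ξ hξ b)) := rfl

theorem IsKernelAction.kerPart_val_mem {g : G} {a : (hD.quotient ξ hξ).carrier}
    (ha : a ∈ (hD.quotient ξ hξ).deg (π g)) :
    D (kerPart π ξ hξ g) (hD.val ξ hξ a) ∈ B.deg g := by
  have h := hD.map_mem (kerPart π ξ hξ g) (hD.val_mem.2 ha)
  rwa [coe_kerPart_mul] at h

theorem IsKernelAction.quotientMap_kerPart_val {g : G} {a : (hD.quotient ξ hξ).carrier}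
    (ha : a ∈ (hD.quotient ξ hξ).deg (π g)) :
    hD.quotientMap ξ hξ (D (kerPart π ξ hξ g) (hD.val ξ hξ a)) = a := by
  apply hD.val_injective
  rw [hD.val_quotientMap, sectionProj_of_mem ξ hξ (hD.kerPart_val_mem ha), map_inv_apply_apply]

theorem IsKernelAction.quotientMap_mem {g : G} {x : B.carrier} (hx : x ∈ B.deg g) :
    hD.quotientMap ξ hξ x ∈ (hD.quotient ξ hξ).deg (π g) :=
  hD.val_mem.1 (hD.sectionProj_mem_deg ξ hξ hx)

theorem IsKernelAction.kerPart_val_quotientMap {g : G} {x : B.carrier} (hx : x ∈ B.deg g) :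
    D (kerPart π ξ hξ g) (hD.val ξ hξ (hD.quotientMap ξ hξ x)) = x := by
  rw [hD.val_quotientMap, sectionProj_of_mem ξ hξ hx, map_apply_inv_apply]

/-- A graded algebra whose product is `loopCocycle χ g k • μ` on components of degrees `g` and `k` is
the loop algebra of the quotient by any action of the kernel compatible with `μ`. -/
noncomputable def IsKernelAction.loopEquiv
    (hμ : ∀ g k, ∀ x ∈ B.deg g, ∀ y ∈ B.deg k, x * y = loopCocycle χ g k • μ x y) :
    GradedEquiv (loop π χ (hD.quotient ξ hξ)).deg B.deg :=
  let F : (loop π χ (hD.quotient ξ hξ)).carrier →ₗ[ℝ] B.carrier :=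
    (loop π χ (hD.quotient ξ hξ)).lift fun g =>
      D (kerPart π ξ hξ g) ∘ₗ hD.val ξ hξ ∘ₗ loopCoord π χ (hD.quotient ξ hξ) g
  let F' : B.carrier →ₗ[ℝ] (loop π χ (hD.quotient ξ hξ)).carrier :=
    B.lift fun g => loopι π χ (hD.quotient ξ hξ) g ∘ₗ hD.quotientMap ξ hξ
  have hF : ∀ g, ∀ a ∈ (hD.quotient ξ hξ).deg (π g),
      F (loopι π χ _ g a) = D (kerPart π ξ hξ g) (hD.val ξ hξ a) := fun g a ha => by
    refine (GrAlg.lift_of_mem _ _ (loopι_mem π χ g a)).trans ?_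
    rw [LinearMap.comp_apply, LinearMap.comp_apply, loopCoord_loopι π χ ha]
  have hF' : ∀ g, ∀ x ∈ B.deg g, F' x = loopι π χ _ g (hD.quotientMap ξ hξ x) := fun g x hx =>
    B.lift_of_mem _ hx
  GradedEquiv.ofInverse F F'
    (fun g x hx => by
      obtain ⟨a, ha, rfl⟩ := exists_eq_loopι π χ hx
      rw [hF g a ha]
      refine ⟨hD.kerPart_val_mem ha, ?_⟩
      rw [hF' g _ (hD.kerPart_val_mem ha), hD.quotientMap_kerPart_val ha])
    (fun g x hx => by
      rw [hF' g x hx]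
      refine ⟨loopι_mem π χ g _, ?_⟩
      rw [hF g _ (hD.quotientMap_mem hx), hD.kerPart_val_quotientMap hx])
    (fun g k x hx y hy => by
      obtain ⟨a, ha, rfl⟩ := exists_eq_loopι π χ hx
      obtain ⟨b, hb, rfl⟩ := exists_eq_loopι π χ hy
      have hab : a * b ∈ (hD.quotient ξ hξ).deg (π (g * k)) :=
        map_mul π g k ▸ (hD.quotient ξ hξ).mul_mem ha hb
      have ha' := hD.val_mem.2 ha
      have hb' := hD.val_mem.2 hb
      -- The operators D leave the product in B through `map_mul_left` and `map_mul_right`; both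
      -- sides become one element of the kernel acting on μ(a, b), and `kerPart_mul_inv_mul`
      -- identifies the two elements.
      rw [loopι_mul π χ ha hb, map_smul, hF _ _ hab, hF g a ha, hF k b hb,
        hμ g k _ (hD.kerPart_val_mem ha) _ (hD.kerPart_val_mem hb), hD.val_mul,
        sectionProj_of_mem ξ hξ (hD.mul_mem ha' hb'),
        ← hD.map_mul_left _ ha' (hD.kerPart_val_mem hb), ← hD.map_mul_right _ ha' hb',
        ← Module.End.mul_apply (D _) (D _), ← Module.End.mul_apply (D _) (D _), ← map_mul D,
        ← map_mul D, kerPart_mul_inv_mul])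

end Quotient

/-! ### The action of the kernel on an algebra with the centroid of a loop algebra -/

section Action

variable {B : GrAlg.{u, max u w} G}
  (e : GradedEquiv (loop π χ (GrAlg.trivialReal Gbar)).deg B.centroidDeg)

/-- The element of the centroid corresponding to `u_g`. -/
noncomputable def centroidUnit (g : G) : centroid B.carrier := e.toLinearEquiv (realι π χ g 1)

theorem apply_realι (g : G) (r : ℝ) :
    e.toLinearEquiv (realι π χ g r) = r • centroidUnit χ e g := by
  rw [centroidUnit, ← map_smul, ← map_smul, smul_eq_mul, mul_one]

theorem centroidUnit_mem (g : G) : centroidUnit χ e g ∈ B.centroidDeg g :=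
  (e.map_mem_iff g _).2 (realι_mem π χ g 1)

theorem centroidUnit_mul {g h : G} (hg : π g = 1) (hh : π h = 1) :
    centroidUnit χ e g * centroidUnit χ e h = loopCocycle χ g h • centroidUnit χ e (g * h) := by
  rw [centroidUnit, centroidUnit, ← e.map_mul, realι_mul π χ hg hh, map_smul, mul_one]
  rfl

/-- In the loop algebra of ℝ, u_1 multiplies everything by c(1, 1). Applying e to this identity at
the preimage of the identity operator gives the claim. -/
theorem centroidUnit_one : centroidUnit χ e 1 = loopCocycle χ 1 1 • 1 := by
  obtain ⟨x, hx⟩ := e.toLinearEquiv.surjective 1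
  have h1 : realι π χ 1 1 * x = loopCocycle χ 1 1 • x := by
    clear hx
    induction x using GrAlg.homogeneous_induction with
    | zero => simp
    | add x y hx hy => rw [mul_add, smul_add, hx, hy]
    | mem g x hx =>
      rcases loop_trivialReal_cases π χ hx with rfl | ⟨hg, r, rfl⟩
      · simp
      · rw [realι_mul π χ (map_one π) hg, loopCocycle_one_left, one_mul, one_mul]
  have h2 := congrArg e.toLinearEquiv h1
  rwa [e.map_mul, map_smul, hx, mul_one] at h2

theorem exists_eq_smul_of_mem_centroidDeg_one
    (e : GradedEquiv (loop π χ (GrAlg.trivialReal Gbar)).deg B.centroidDeg)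
    {c : centroid B.carrier}
    (hc : c ∈ B.centroidDeg 1) : ∃ r : ℝ, c = r • 1 := by
  obtain ⟨x, rfl⟩ := e.toLinearEquiv.surjective c
  rcases loop_trivialReal_cases π χ ((e.map_mem_iff 1 x).1 hc) with rfl | ⟨-, r, rfl⟩
  · exact ⟨0, by simp⟩
  · exact ⟨r * loopCocycle χ 1 1, by rw [apply_realι, centroidUnit_one, smul_smul]⟩

theorem eq_zero_of_mem_centroidDeg_ne
    (e : GradedEquiv (loop π χ (GrAlg.trivialReal Gbar)).deg B.centroidDeg)
    {g : G} (hg : π g ≠ 1) {c : centroid B.carrier}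
    (hc : c ∈ B.centroidDeg g) : c = 0 := by
  obtain ⟨x, rfl⟩ := e.toLinearEquiv.surjective c
  rcases loop_trivialReal_cases π χ ((e.map_mem_iff g x).1 hc) with rfl | ⟨h, -⟩
  · exact map_zero _
  · exact absurd h hg

/-- The operator `x ↦ (loopCocycle χ h g)⁻¹ • c_h x` for `x` of degree `g`. -/
noncomputable def kernelActionEnd (h : π.ker) : Module.End ℝ B.carrier :=
  B.lift fun g => (loopCocycle χ (h : G) g)⁻¹ • (centroidUnit χ e (h : G) : Module.End ℝ B.carrier)

theorem kernelActionEnd_of_mem (h : π.ker) {g : G} {x : B.carrier} (hx : x ∈ B.deg g) :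
    kernelActionEnd χ e h x =
      (loopCocycle χ (h : G) g)⁻¹ • (centroidUnit χ e (h : G) : Module.End ℝ B.carrier) x :=
  B.lift_of_mem _ hx

theorem kernelActionEnd_mem (h : π.ker) {g : G} {x : B.carrier} (hx : x ∈ B.deg g) :
    kernelActionEnd χ e h x ∈ B.deg (h * g) := by
  rw [kernelActionEnd_of_mem χ e h hx]
  exact Submodule.smul_mem _ _ (centroidUnit_mem χ e h g x hx)

/-- The action of the kernel on an algebra with the centroid of a loop algebra, obtained by
normalizing the action of the elements `u_h` of the centroid. -/
noncomputable def kernelAction : π.ker →* Module.End ℝ B.carrier where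
  toFun := kernelActionEnd χ e
  map_one' := GrAlg.hom_ext fun g x hx => by
    rw [kernelActionEnd_of_mem χ e 1 hx, OneMemClass.coe_one, centroidUnit_one,
      loopCocycle_one_left]
    exact inv_smul_smul₀ (loopCocycle_ne_zero χ 1 1) x
  map_mul' h k := GrAlg.hom_ext fun g x hx => by
    rw [Module.End.mul_apply, kernelActionEnd_of_mem χ e _ hx,
      kernelActionEnd_of_mem χ e h (kernelActionEnd_mem χ e k hx),
      kernelActionEnd_of_mem χ e k hx, map_smul]
    have h1 := centroidUnit_mul χ e h.2 k.2
    have h2 : (centroidUnit χ e (h : G) : Module.End ℝ B.carrier)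
        ((centroidUnit χ e (k : G) : Module.End ℝ B.carrier) x) = loopCocycle χ (h : G) k •
          (centroidUnit χ e ((h : G) * k) : Module.End ℝ B.carrier) x :=
      congrArg (fun c : centroid B.carrier => (c : Module.End ℝ B.carrier) x) h1
    rw [h2, smul_smul, smul_smul, Subgroup.coe_mul]
    congr 1
    -- The factors c(h, g)⁻¹ were chosen so that the cocycle identity turns the projective relation
    -- c_h c_k = c(h, k) c_{hk} into an honest action.
    have h3 := loopCocycle_assoc χ (h : G) k g
    have n1 := loopCocycle_ne_zero χ (h : G) k
    have n2 := loopCocycle_ne_zero χ (h * k : G) g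
    have n3 := loopCocycle_ne_zero χ (k : G) g
    have n4 := loopCocycle_ne_zero χ (h : G) (k * g)
    field_simp
    linear_combination -h3

theorem kernelAction_of_mem (h : π.ker) {g : G} {x : B.carrier} (hx : x ∈ B.deg g) :
    kernelAction χ e h x =
      (loopCocycle χ (h : G) g)⁻¹ • (centroidUnit χ e (h : G) : Module.End ℝ B.carrier) x :=
  kernelActionEnd_of_mem χ e h hx

theorem kernelAction_mem (h : π.ker) {g : G} {x : B.carrier} (hx : x ∈ B.deg g) :
    kernelAction χ e h x ∈ B.deg (h * g) :=
  kernelActionEnd_mem χ e h hx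

/-- Dividing the product of B by the cocycle compensates for the scalars in the action.
Compatibility on the left is the cocycle identity; on the right it also needs symmetry. -/
theorem isKernelAction_kernelAction : IsKernelAction π B
    (B.twistMul fun g k => (loopCocycle χ g k)⁻¹) (kernelAction χ e) where
  mul_mem hx hy := by
    rw [B.twistMul_of_mem _ hx hy]
    exact Submodule.smul_mem _ _ (B.mul_mem hx hy)
  map_mem h _ _ hx := kernelAction_mem χ e h hx
  map_mul_left h p q x y hx hy := by
    rw [B.twistMul_of_mem _ hx hy, B.twistMul_of_mem _ (kernelAction_mem χ e h hx) hy, map_smul,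
      kernelAction_of_mem χ e h (B.mul_mem hx hy), kernelAction_of_mem χ e h hx,
      ((centroidUnit χ e (h : G)).2 x y).2, smul_mul_assoc, smul_smul, smul_smul, ← mul_inv,
      ← mul_inv, ← loopCocycle_assoc, mul_comm]
  map_mul_right h p q x y hx hy := by
    rw [B.twistMul_of_mem _ hx hy, B.twistMul_of_mem _ hx (kernelAction_mem χ e h hy), map_smul,
      kernelAction_of_mem χ e h (B.mul_mem hx hy), kernelAction_of_mem χ e h hy,
      ((centroidUnit χ e (h : G)).2 x y).1, mul_smul_comm, smul_smul, smul_smul, ← mul_inv,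
      ← mul_inv, ← loopCocycle_left_comm, mul_comm]

end Action

/-- A is the quotient of B, with its product divided by the cocycle, by the normalized action of the
kernel. Conjugation by φ carries centroid elements of the loop algebra of A to those of B, where e
describes them by degree, and this yields the hypotheses of `isCentralSimple_of_loop`. -/
theorem exists_loop_equiv (ξ : Gbar → G) (hξ : Function.RightInverse ξ π)
    {B : GrAlg.{u, max u w} G} (hB : HasLoopCentroid π χ B) :
    ∃ A : GrAlg.{v, max u w} Gbar, ∃ _ : GradedEquiv (loop π χ A).deg B.deg, A.IsCentralSimple := by
  obtain ⟨hsimple, ⟨e⟩⟩ := hB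
  have hD := isKernelAction_kernelAction χ e
  let φ : GradedEquiv (loop π χ (hD.quotient ξ hξ)).deg B.deg :=
    hD.loopEquiv χ fun g k x hx y hy => by
      rw [B.twistMul_of_mem _ hx hy, smul_inv_smul₀ (loopCocycle_ne_zero χ g k)]
  refine ⟨_, φ, isCentralSimple_of_loop π χ hξ.surjective (φ.symm.isGradedSimple hsimple)
    (fun c hc => ?_) (fun g hg c hc => ?_)⟩
  · obtain ⟨r, hr⟩ := exists_eq_smul_of_mem_centroidDeg_one χ e (φ.centroidConj_mem hc)
    refine ⟨r, Subtype.ext (LinearMap.ext fun x => φ.toLinearEquiv.injective ?_)⟩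
    rw [← φ.centroidConj_apply, hr]
    exact (map_smul φ.toLinearEquiv r x).symm
  · have h0 := eq_zero_of_mem_centroidDeg_ne χ e hg (φ.centroidConj_mem hc)
    refine Subtype.ext (LinearMap.ext fun x => φ.toLinearEquiv.injective ?_)
    rw [← φ.centroidConj_apply, h0]
    exact (map_zero φ.toLinearEquiv).symm

end EssentiallySurjective

end LoopGr

/-! ### The equivalence of groupoids. -/

theorem theorem3p8 {G : Type u} {Gbar : Type v} [CommGroup G] [CommGroup Gbar]
    (π : G →* Gbar) (χ : G →* Circle) (ξ : Gbar → G) (hξ : Function.RightInverse ξ π) :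
    ∃ h : ∀ A : LoopGr.ExtObj.{u, v, max u w} π ξ hξ,
        LoopGr.HasLoopCentroid π χ ((LoopGr.extLoopFunctor π χ ξ hξ).obj A),
      ((LoopGr.HasLoopCentroid.{u, v, max u w} π χ).lift
        (LoopGr.extLoopFunctor π χ ξ hξ) h).IsEquivalence := by
  have h : ∀ A : LoopGr.ExtObj.{u, v, max u w} π ξ hξ,
      LoopGr.HasLoopCentroid π χ ((LoopGr.extLoopFunctor π χ ξ hξ).obj A) := fun A =>
    LoopGr.hasLoopCentroid_loop π χ hξ.surjective A.centralSimple
  refine ⟨h, .mk (faithful := ⟨fun {A A' f f'} hf => ?_⟩) (full := ⟨fun {A A'} φ => ?_⟩)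
    (essSurj := ⟨fun B => ?_⟩)⟩
  · exact LoopGr.loopMap_injective π χ (congrArg (fun x => x.hom) hf)
  · obtain ⟨f, hf⟩ := LoopGr.exists_loopMap_eq π χ φ.hom
    exact ⟨f, ObjectProperty.hom_ext _ hf⟩
  · obtain ⟨A, φ, hA⟩ := LoopGr.exists_loop_equiv χ ξ hξ B.property
    refine ⟨⟨A, hA⟩, ⟨(Groupoid.isoEquivHom _ _).symm (ObjectProperty.homMk ?_)⟩⟩
    exact φ
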